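/- Let $a>0$ be a real algebraic number, $a\neq 1$. Let $B_a\subset\mathbb R$ be the additive group of all finite sums $\sum_i m_i a^{n_i}$ with $m_i,n_i\in\mathbb Z$, taken with the discrete topology, let $\alpha(k)b=a^k b$ for $k\in\mathbb Z$, and let $G_a=B_a\rtimes_\alpha\mathbb Z$, with product $(b,k)(b',k')=(b+a^kb',k+k')$. Let $\mathcal U_a=C^*(G_a)$ be the full group C*-algebra; unitary representations of $G_a$ are extended to $\mathcal U_a$. On the compact dual group $\widehat B_a$ let $\widehat\alpha(\chi)=\chi\circ\alpha(1)$. A character $\chi$ is $q$-periodic ($q\ge 1$) if $\widehat\alpha^q(\chi)=\chi$ and $\widehat\alpha^k(\chi)\ne\chi$ for $0<k<q$, and it is aperiodic if it is $q$-periodic for no $q$. Let $Q_a=\sum_{j=0}^d q_jx^j\in\mathbb Z[x]$ be the minimal polynomial of $a$ over $\mathbb Q$ multiplied by the least common denominator of its coefficients. Let $A_a$ be the integer $d\times d$ matrix with $(A_a)_{i,i+1}=q_d$ for $1\le i<d$, with last row $(-q_0,\dots,-q_{d-1})$, and with all other entries $0$. Let $K_a=\{z\in(\mathbb T^d)^{\mathbb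 Z}: q_d z_{k+1}=A_a z_k \text{ for all } k\}$, where $\mathbb T\simeq\mathbb R/\mathbb Z$, let $S_a$ be the connected component of the identity of $K_a$, and let $\sigma$ be the shift $(\sigma z)_k=z_{k+1}$ on $S_a$. The group $\widehat B_a$ is identified with $S_a$ through the topological group isomorphism $\psi:\widehat B_a\to S_a$, $\psi(\chi)_k^{(i)}=\chi(a^{k+i-1})$; it carries $\widehat\alpha$ to $\sigma$. For $\chi\in\widehat B_a$ let $\mathcal H_\chi^{\mathrm{Ind}}$ be the Hilbert space of functions $\varphi:G_a\to\mathbb C$ with $\varphi(b,k)=\chi(b)\varphi(0,k)$ and $\|\varphi\|^2=\sum_{k\in\mathbb Z}|\varphi(0,k)|^2<\infty$, and let $(\pi_\chi^{\mathrm{Ind}}(g)\varphi)(h)=\varphi(hg)$. The induced representations of $\mathcal U_a$ are those unitarily equivalent to some $\pi_\chi^{\mathrm{Ind}}$. Then: (i) The map above is indeed a topological group isomorphism of $\widehat B_a$ onto $S_a$, and $\psi(\chi)\mapsto\pi_\chi^{\mathrm{Ind}}$ induces a bijection from the set of orbits of $\sigma$ (that is, of $\widehat\alpha$) in $S_a$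 onto the set of unitary equivalence classes of induced representations of $\mathcal U_a$. (ii) $\pi_\chi^{\mathrm{Ind}}$ is irreducible if and only if $\chi$ is aperiodic. (iii) If $\chi$ is $q$-periodic, the commutant of $\pi_\chi^{\mathrm{Ind}}$ is the commutative von Neumann algebra of functions on the circle: there is an isometric $*$-isomorphism $\Phi$ of $L^\infty(\mathbb T)$ onto the commutant, and the commutant is the von Neumann algebra generated by $\Phi(C(\mathbb T))$ (the bicommutant of $\Phi(C(\mathbb T))$). (iv) The right regular representation of $\mathcal U_a$ on $\ell^2(G_a)$, $(R(g)f)(h)=f(hg)$, is unitarily equivalent to $\int_{\widehat B_a}^{\oplus}\pi_\chi^{\mathrm{Ind}}\,d\mu(\chi)$, where $\mu$ is the normalized Haar measure of $\widehat B_a$ and the measurable structure of the field $\chi\mapsto\mathcal H_\chi^{\mathrm{Ind}}$ is given by the orthonormal bases $e_k^\chi(b,l)=\chi(b)\delta_{k,l}$, $k\in\mathbb Z$. -/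

import Mathlib

open scoped ENNReal InnerProductSpace
open MeasureTheory

noncomputable section

/-! ### The discrete group `B_a`, the group `G_a`, and the dual automorphism -/

/-- The additive subgroup `B_a = {∑ mᵢ a^{nᵢ}}` of `ℝ`, with `mᵢ, nᵢ ∈ ℤ` and finite sums. -/
def BAdd (a : ℝˣ) : AddSubgroup ℝ :=
  AddSubgroup.closure (Set.range fun n : ℤ => ((a ^ n : ℝˣ) : ℝ))

/-- `B_a` written multiplicatively, as a discrete group. -/
def BGrp (a : ℝˣ) : Type := Multiplicative (BAdd a)

instance (a : ℝˣ) : CommGroup (BGrp a) := inferInstanceAs (CommGroup (Multiplicative (BAdd a)))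

instance (a : ℝˣ) : TopologicalSpace (BGrp a) := ⊥

instance (a : ℝˣ) : DiscreteTopology (BGrp a) := ⟨rfl⟩

/-- The real number underlying an element of `B_a`. -/
def BGrp.val {a : ℝˣ} (b : BGrp a) : ℝ := ((Multiplicative.toAdd b : BAdd a) : ℝ)

/-- The element `a ^ n` of `B_a`. -/
def BGrp.pow (a : ℝˣ) (n : ℤ) : BGrp a :=
  Multiplicative.ofAdd (⟨((a ^ n : ℝˣ) : ℝ), AddSubgroup.subset_closure ⟨n, rfl⟩⟩ : BAdd a)

theorem BGrp.ext {a : ℝˣ} {b c : BGrp a} (h : b.val = c.val) : b = c :=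
  congrArg Multiplicative.ofAdd (Subtype.ext h : (Multiplicative.toAdd b : BAdd a) = _)

theorem BGrp.val_mul {a : ℝˣ} (b c : BGrp a) : (b * c).val = b.val + c.val := rfl

theorem BAdd.mul_mem (a : ℝˣ) (n : ℤ) {b : ℝ} (hb : b ∈ BAdd a) :
    ((a ^ n : ℝˣ) : ℝ) * b ∈ BAdd a := by
  unfold BAdd at hb ⊢
  induction hb using AddSubgroup.closure_induction with
  | mem x hx =>
    obtain ⟨m, rfl⟩ := hx
    exact AddSubgroup.subset_closure ⟨n + m, by simp [zpow_add]⟩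
  | zero => simp
  | add x y _ _ hx hy => rw [mul_add]; exact add_mem hx hy
  | neg x _ hx => rw [mul_neg]; exact neg_mem hx

/-- Multiplication by `a ^ n` on `B_a`. -/
def BGrp.smul {a : ℝˣ} (n : ℤ) (b : BGrp a) : BGrp a :=
  Multiplicative.ofAdd (⟨((a ^ n : ℝˣ) : ℝ) * b.val,
    BAdd.mul_mem a n (Multiplicative.toAdd b : BAdd a).2⟩ : BAdd a)

theorem BGrp.val_smul {a : ℝˣ} (n : ℤ) (b : BGrp a) :
    (BGrp.smul n b).val = ((a ^ n : ℝˣ) : ℝ) * b.val := rfl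

theorem BGrp.smul_smul {a : ℝˣ} (m n : ℤ) (b : BGrp a) :
    BGrp.smul m (BGrp.smul n b) = BGrp.smul (m + n) b :=
  BGrp.ext (by simp only [BGrp.val_smul, zpow_add, Units.val_mul, mul_assoc])

theorem BGrp.smul_zero {a : ℝˣ} (b : BGrp a) : BGrp.smul 0 b = b :=
  BGrp.ext (by simp [BGrp.val_smul])

theorem BGrp.smul_mul {a : ℝˣ} (n : ℤ) (b c : BGrp a) :
    BGrp.smul n (b * c) = BGrp.smul n b * BGrp.smul n c :=
  BGrp.ext (by simp only [BGrp.val_smul, BGrp.val_mul, mul_add])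

/-- The action `α_a` of `ℤ` on `B_a`: `α_a(n) b = a ^ n b`. -/
def alpha (a : ℝˣ) : Multiplicative ℤ →* MulAut (BGrp a) where
  toFun n :=
    { toFun := BGrp.smul n.toAdd
      invFun := BGrp.smul (-n.toAdd)
      left_inv := fun b => by rw [BGrp.smul_smul, neg_add_cancel, BGrp.smul_zero]
      right_inv := fun b => by rw [BGrp.smul_smul, add_neg_cancel, BGrp.smul_zero]
      map_mul' := BGrp.smul_mul _ }
  map_one' := MulEquiv.ext fun b => BGrp.smul_zero b
  map_mul' m n := MulEquiv.ext fun b => (BGrp.smul_smul _ _ b).symm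

/-- `G_a = B_a ⋊ ℤ`, with `(b, k)(b', k') = (b + a ^ k b', k + k')`. -/
abbrev GGrp (a : ℝˣ) : Type := BGrp a ⋊[alpha a] Multiplicative ℤ

/-- The element `(b, k)` of `G_a`. -/
def GGrp.mk {a : ℝˣ} (b : BGrp a) (k : ℤ) : GGrp a := ⟨b, Multiplicative.ofAdd k⟩

/-- The exponent `k` of `(b, k) ∈ G_a`. -/
def GGrp.exp {a : ℝˣ} (g : GGrp a) : ℤ := Multiplicative.toAdd g.right

theorem GGrp.mk_eta {a : ℝˣ} (g : GGrp a) : GGrp.mk g.left g.exp = g := rfl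

theorem GGrp.mk_mul {a : ℝˣ} (b : BGrp a) (k : ℤ) (g : GGrp a) :
    GGrp.mk b k * g = GGrp.mk (b * BGrp.smul k g.left) (k + g.exp) := rfl

/-- The Pontryagin dual of the discrete group `B_a`, a compact abelian group. -/
abbrev BDual (a : ℝˣ) : Type := PontryaginDual (BGrp a)

instance (a : ℝˣ) : MeasurableSpace (BDual a) := borel _

instance (a : ℝˣ) : BorelSpace (BDual a) := ⟨rfl⟩

/-- The normalized Haar measure of the dual of `B_a`. -/
def haarDual (a : ℝˣ) : Measure (BDual a) := Measure.haarMeasure ⊤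

/-- The character `χ ∘ α_a(n)`. -/
def BDual.comp {a : ℝˣ} (n : ℤ) (χ : BDual a) : BDual a :=
  PontryaginDual.map
    ({ toMonoidHom := (alpha a (Multiplicative.ofAdd n)).toMonoidHom
       continuous_toFun := continuous_of_discreteTopology } : BGrp a →ₜ* BGrp a) χ

theorem BDual.comp_apply {a : ℝˣ} (n : ℤ) (χ : BDual a) (b : BGrp a) :
    BDual.comp n χ b = χ (BGrp.smul n b) := rfl

/-- The automorphism `χ ↦ χ ∘ α_a(1)` of the dual of `B_a`, that is `(α̂ χ)(b) = χ(a b)`. -/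
def dualAut (a : ℝˣ) : Equiv.Perm (BDual a) where
  toFun := BDual.comp 1
  invFun := BDual.comp (-1)
  left_inv χ := PontryaginDual.ext fun b => by
    rw [BDual.comp_apply, BDual.comp_apply, BGrp.smul_smul, add_neg_cancel, BGrp.smul_zero]
  right_inv χ := PontryaginDual.ext fun b => by
    rw [BDual.comp_apply, BDual.comp_apply, BGrp.smul_smul, neg_add_cancel, BGrp.smul_zero]

/-- `χ` has exact period `q` under the dual automorphism. -/
def IsPeriodicPt (a : ℝˣ) (q : ℕ) (χ : BDual a) : Prop :=
  0 < q ∧ (dualAut a ^ q) χ = χ ∧ ∀ k : ℕ, 0 < k → k < q → (dualAut a ^ k) χ ≠ χ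

/-- `χ` is not periodic under the dual automorphism. -/
def IsAperiodicPt (a : ℝˣ) (χ : BDual a) : Prop :=
  ∀ k : ℕ, 0 < k → (dualAut a ^ k) χ ≠ χ

/-! ### The solenoid `S_a` -/

/-- The least common denominator of the coefficients of a rational polynomial. -/
def commonDen (p : Polynomial ℚ) : ℕ := p.support.lcm fun i => (p.coeff i).den

/-- The polynomial `Q_a ∈ ℤ[x]`: the minimal polynomial of `a` over `ℚ`, multiplied by the least
common denominator of its coefficients. -/
def intMinpoly (a : ℝ) : Polynomial ℤ :=
  ∑ i ∈ Finset.range ((minpoly ℚ a).natDegree + 1),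
    Polynomial.monomial i (commonDen (minpoly ℚ a) * (minpoly ℚ a).coeff i).num

theorem map_intMinpoly (a : ℝ) : (intMinpoly a).map (Int.castRingHom ℚ) =
    Polynomial.C (commonDen (minpoly ℚ a) : ℚ) * minpoly ℚ a := by
  ext i
  rw [Polynomial.coeff_map, Polynomial.coeff_C_mul, intMinpoly, Polynomial.finsetSum_coeff]
  simp only [Polynomial.coeff_monomial, Finset.sum_ite_eq', Finset.mem_range]
  split_ifs with h
  · by_cases h0 : (minpoly ℚ a).coeff i = 0
    · simp [h0]
    · obtain ⟨c, hc⟩ : ((minpoly ℚ a).coeff i).den ∣ commonDen (minpoly ℚ a) :=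
        Finset.dvd_lcm (f := fun i => ((minpoly ℚ a).coeff i).den)
          (Polynomial.mem_support_iff.2 h0)
      have : (commonDen (minpoly ℚ a) : ℚ) * (minpoly ℚ a).coeff i =
          ((c * ((minpoly ℚ a).coeff i).num : ℤ) : ℚ) := by
        rw [hc]
        conv_lhs => rw [← Rat.num_div_den ((minpoly ℚ a).coeff i)]
        have : (((minpoly ℚ a).coeff i).den : ℚ) ≠ 0 := by positivity
        push_cast
        field_simp
        rw [Rat.num_div_den]
      rw [this, Rat.num_intCast, eq_intCast]
  · rw [Polynomial.coeff_eq_zero_of_natDegree_lt (by omega)]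
    simp

/-- The degree `d` of `Q_a`. -/
def polyDeg (a : ℝ) : ℕ := (intMinpoly a).natDegree

/-- The `d × d` integer matrix `A_a`: `q_d` on the superdiagonal, last row
`(-q_0, …, -q_{d-1})`, and zeros elsewhere, where `Q_a = ∑ q_j x^j`. -/
def companion (a : ℝ) : Matrix (Fin (polyDeg a)) (Fin (polyDeg a)) ℤ :=
  Matrix.of fun i j =>
    if (i : ℕ) + 1 = polyDeg a then -(intMinpoly a).coeff j
    else if (j : ℕ) = i + 1 then (intMinpoly a).coeff (polyDeg a) else 0

/-- `K_a = {z ∈ (𝕋^d)^ℤ : q_d z_{k+1} = A_a z_k}`, with the circle group written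
multiplicatively. -/
def KGrp (a : ℝ) : Subgroup (ℤ → Fin (polyDeg a) → Circle) where
  carrier := {z | ∀ k i, z (k + 1) i ^ (intMinpoly a).coeff (polyDeg a) =
    ∏ j, z k j ^ companion a i j}
  one_mem' := by intro k i; simp
  mul_mem' := by
    intro y z hy hz k i
    simp only [Pi.mul_apply, mul_zpow, Finset.prod_mul_distrib]
    rw [hy k i, hz k i]
  inv_mem' := by
    intro z hz k i
    simp only [Pi.inv_apply, inv_zpow, Finset.prod_inv_distrib]
    rw [hz k i]

/-- `S_a`, the connected component of the identity of `K_a`. -/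
abbrev Solenoid (a : ℝ) : Type := Subgroup.connectedComponentOfOne (KGrp a)

/-- The coordinate `z_k^{(i)}` of a point of `S_a`, with `i` counted from `0`. -/
def Solenoid.coord {a : ℝ} (z : Solenoid a) (k : ℤ) (i : Fin (polyDeg a)) : Circle :=
  ((z : KGrp a) : ℤ → Fin (polyDeg a) → Circle) k i

/-- Translation of the time index by `n` on `K_a`. -/
def KGrp.translate {a : ℝ} (n : ℤ) (z : KGrp a) : KGrp a :=
  ⟨fun k => z.1 (k + n), fun k i => by
    have h := z.2 (k + n) i
    rwa [add_right_comm] at h⟩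

theorem KGrp.continuous_translate {a : ℝ} (n : ℤ) :
    Continuous (KGrp.translate n : KGrp a → KGrp a) := by
  refine Continuous.subtype_mk (continuous_pi fun k => ?_) _
  exact (continuous_apply (k + n)).comp continuous_subtype_val

theorem KGrp.translate_mem {a : ℝ} (n : ℤ) {z : KGrp a}
    (hz : z ∈ Subgroup.connectedComponentOfOne (KGrp a)) :
    KGrp.translate n z ∈ Subgroup.connectedComponentOfOne (KGrp a) :=
  (KGrp.continuous_translate n).image_connectedComponent_subset (1 : KGrp a) ⟨z, hz, rfl⟩

/-- The shift `(σ z)_k = z_{k+1}` on `S_a`. -/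
def shift (a : ℝ) : Equiv.Perm (Solenoid a) where
  toFun z := ⟨KGrp.translate 1 z.1, KGrp.translate_mem 1 z.2⟩
  invFun z := ⟨KGrp.translate (-1) z.1, KGrp.translate_mem (-1) z.2⟩
  left_inv z := by
    refine Subtype.ext (Subtype.ext (funext fun k => ?_))
    exact congrArg z.1.1 (neg_add_cancel_right k 1)
  right_inv z := by
    refine Subtype.ext (Subtype.ext (funext fun k => ?_))
    exact congrArg z.1.1 (add_neg_cancel_right k 1)

/-- The set of orbits of the shift in `S_a`. -/
abbrev SolenoidOrbits (a : ℝ) : Type := Quotient (Equiv.Perm.SameCycle.setoid (shift a))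

/-! ### The group C*-algebra of a discrete group and its representations -/

/-- A unitary representation of a discrete group on a nonzero complex Hilbert space. -/
structure UnitaryRep (G : Type) [Group G] : Type 1 where
  H : Type
  [normed : NormedAddCommGroup H]
  [inner : InnerProductSpace ℂ H]
  [complete : CompleteSpace H]
  [nontrivial : Nontrivial H]
  U : G →* (H ≃ₗᵢ[ℂ] H)

attribute [instance] UnitaryRep.normed UnitaryRep.inner UnitaryRep.complete UnitaryRep.nontrivial

/-- The C*-algebra of all bounded families of operators, one for each unitary representation of
`G`. -/
abbrev UniversalProduct (G : Type) [Group G] : Type 1 :=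
  lp (fun π : UnitaryRep G => π.H →L[ℂ] π.H) ∞

theorem norm_isometryEquiv_le {H : Type} [NormedAddCommGroup H] [InnerProductSpace ℂ H]
    (V : H ≃ₗᵢ[ℂ] H) : ‖((V : H ≃L[ℂ] H) : H →L[ℂ] H)‖ ≤ 1 :=
  ContinuousLinearMap.opNorm_le_bound _ zero_le_one fun x => by simp

/-- The image of a group element in the universal representation. -/
def universalElt {G : Type} [Group G] (g : G) : UniversalProduct G :=
  ⟨fun π => ((π.U g : π.H ≃L[ℂ] π.H) : π.H →L[ℂ] π.H),
    memℓp_infty ⟨1, by rintro _ ⟨π, rfl⟩; exact norm_isometryEquiv_le _⟩⟩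

/-- The full group C*-algebra `C*(G)` of a discrete group: the norm closure of the *-algebra
generated by `G` in the product of all its unitary representations. -/
def groupCStarSubalgebra (G : Type) [Group G] : StarSubalgebra ℂ (UniversalProduct G) :=
  (StarAlgebra.adjoin ℂ (Set.range (universalElt : G → UniversalProduct G))).topologicalClosure

/-- The full group C*-algebra as a type. -/
def GroupCStar (G : Type) [Group G] : Type 1 := groupCStarSubalgebra G

instance (G : Type) [Group G] : CStarAlgebra (GroupCStar G) :=
  { (inferInstance : NormedRing (groupCStarSubalgebra G)),
    (inferInstance : StarRing (groupCStarSubalgebra G)),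
    (inferInstance : NormedAlgebra ℂ (groupCStarSubalgebra G)),
    (inferInstance : StarModule ℂ (groupCStarSubalgebra G)),
    (inferInstance : CStarRing (groupCStarSubalgebra G)) with
    complete := ((StarSubalgebra.isClosed_topologicalClosure _).completeSpace_coe :
      CompleteSpace (groupCStarSubalgebra G)).complete }

/-- The family of operators underlying an element of `C*(G)`. -/
def GroupCStar.val {G : Type} [Group G] (x : GroupCStar G) : UniversalProduct G :=
  (show groupCStarSubalgebra G from x).1

/-- The canonical unitary of `C*(G)` attached to `g ∈ G`. -/
def GroupCStar.of {G : Type} [Group G] (g : G) : GroupCStar G :=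
  (⟨universalElt g, StarSubalgebra.le_topologicalClosure _
    (StarAlgebra.subset_adjoin _ _ ⟨g, rfl⟩)⟩ : groupCStarSubalgebra G)

/-- The representation of `C*(G)` that extends a unitary representation of `G`. -/
def GroupCStar.lift {G : Type} [Group G] {H : Type} [NormedAddCommGroup H]
    [InnerProductSpace ℂ H] [CompleteSpace H] [Nontrivial H] (U : G →* (H ≃ₗᵢ[ℂ] H)) :
    GroupCStar G →⋆ₐ[ℂ] (H →L[ℂ] H) where
  toFun x := x.val { H := H, U := U }
  map_one' := rfl
  map_mul' _ _ := rfl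
  map_zero' := rfl
  map_add' _ _ := rfl
  commutes' _ := rfl
  map_star' _ := rfl

theorem GroupCStar.lift_of {G : Type} [Group G] {H : Type} [NormedAddCommGroup H]
    [InnerProductSpace ℂ H] [CompleteSpace H] [Nontrivial H] (U : G →* (H ≃ₗᵢ[ℂ] H)) (g : G) :
    GroupCStar.lift U (GroupCStar.of g) = ((U g : H ≃L[ℂ] H) : H →L[ℂ] H) := rfl

/-- Unitary equivalence of two representations of a *-algebra on Hilbert spaces. -/
def UnitarilyEquivalent {A : Type*} [Ring A] [StarRing A] [Algebra ℂ A]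
    {H K : Type*} [NormedAddCommGroup H] [InnerProductSpace ℂ H] [CompleteSpace H]
    [NormedAddCommGroup K] [InnerProductSpace ℂ K] [CompleteSpace K]
    (π : A →⋆ₐ[ℂ] (H →L[ℂ] H)) (ρ : A →⋆ₐ[ℂ] (K →L[ℂ] K)) : Prop :=
  ∃ W : H ≃ₗᵢ[ℂ] K, ∀ (x : A) (ξ : H), W (π x ξ) = ρ x (W ξ)

/-- A representation on a nonzero Hilbert space is irreducible if it has no closed invariant
subspace except `0` and the whole space. -/
def IsIrreducibleRep {A : Type*} [Ring A] [StarRing A] [Algebra ℂ A]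
    {H : Type*} [NormedAddCommGroup H] [InnerProductSpace ℂ H] [CompleteSpace H]
    (π : A →⋆ₐ[ℂ] (H →L[ℂ] H)) : Prop :=
  Nontrivial H ∧ ∀ K : Submodule ℂ H, IsClosed (K : Set H) →
    (∀ (x : A), ∀ ξ ∈ K, π x ξ ∈ K) → K = ⊥ ∨ K = ⊤

/-- The commutant of a representation, a *-subalgebra of the bounded operators. -/
def commutant {A : Type*} [Ring A] [StarRing A] [Algebra ℂ A]
    {H : Type*} [NormedAddCommGroup H] [InnerProductSpace ℂ H] [CompleteSpace H]
    (π : A →⋆ₐ[ℂ] (H →L[ℂ] H)) : StarSubalgebra ℂ (H →L[ℂ] H) :=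
  StarSubalgebra.centralizer ℂ (Set.range π)

/-- A representation of `A` together with its Hilbert space. -/
structure HilbertRep (A : Type*) [Ring A] [StarRing A] [Algebra ℂ A] where
  H : Type
  [normed : NormedAddCommGroup H]
  [inner : InnerProductSpace ℂ H]
  [complete : CompleteSpace H]
  hom : A →⋆ₐ[ℂ] (H →L[ℂ] H)

attribute [instance] HilbertRep.normed HilbertRep.inner HilbertRep.complete

/-- Unitary equivalence as an equivalence relation on representations. -/
instance HilbertRep.setoid (A : Type*) [Ring A] [StarRing A] [Algebra ℂ A] :
    Setoid (HilbertRep A) where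
  r π ρ := UnitarilyEquivalent π.hom ρ.hom
  iseqv :=
    { refl := fun π => ⟨LinearIsometryEquiv.refl ℂ π.H, fun _ _ => rfl⟩
      symm := by
        rintro π ρ ⟨W, hW⟩
        exact ⟨W.symm, fun x ξ => by
          rw [LinearIsometryEquiv.symm_apply_eq, hW, LinearIsometryEquiv.apply_symm_apply]⟩
      trans := by
        rintro π ρ τ ⟨V, hV⟩ ⟨W, hW⟩
        exact ⟨V.trans W, fun x ξ => by
          rw [LinearIsometryEquiv.trans_apply, hV, hW, LinearIsometryEquiv.trans_apply]⟩ }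

/-- Unitary equivalence classes of representations. -/
abbrev RepClass (A : Type*) [Ring A] [StarRing A] [Algebra ℂ A] := Quotient (HilbertRep.setoid A)

/-- The class of a representation. -/
def repClass {A : Type*} [Ring A] [StarRing A] [Algebra ℂ A]
    {H : Type} [NormedAddCommGroup H] [InnerProductSpace ℂ H] [CompleteSpace H]
    (π : A →⋆ₐ[ℂ] (H →L[ℂ] H)) : RepClass A :=
  Quotient.mk _ { H := H, hom := π }

/-! ### Direct integrals -/

section DirectIntegral

variable {X : Type} [MeasurableSpace X] {ι : Type} [Countable ι]
  {H : X → Type} [∀ x, NormedAddCommGroup (H x)] [∀ x, InnerProductSpace ℂ (H x)]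

/-- Measurability of a section `s` of a field of Hilbert spaces `H x`, where the measurable
structure of the field is given by a field of Hilbert bases: all coordinate functions
`x ↦ ⟪b x i, s x⟫` are (almost everywhere) measurable. -/
def IsMeasurableSection (b : ∀ x, HilbertBasis ι ℂ (H x)) (μ : Measure X) (s : ∀ x, H x) : Prop :=
  ∀ i, AEMeasurable (fun x => inner ℂ (b x i) (s x)) μ

/-- Square integrability of a section: it is measurable and `∫ ‖s x‖² dμ(x) < ∞`. -/
def IsL2Section (b : ∀ x, HilbertBasis ι ℂ (H x)) (μ : Measure X) (s : ∀ x, H x) : Prop :=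
  IsMeasurableSection b μ s ∧ ∫⁻ x, ‖s x‖ₑ ^ 2 ∂μ < ∞

theorem isL2Section_iff (b : ∀ x, HilbertBasis ι ℂ (H x)) (μ : Measure X) (s : ∀ x, H x) :
    IsL2Section b μ s ↔ MemLp (fun x => (b x).repr (s x)) 2 μ := by
  classical
  have hm : IsMeasurableSection b μ s ↔
      AEStronglyMeasurable (fun x => (b x).repr (s x)) μ := by
    constructor
    · intro h
      have hs : ∀ x, HasSum (fun i => lp.single 2 i ((b x).repr (s x) i)) ((b x).repr (s x)) :=
        fun x => lp.hasSum_single (by norm_num) _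
      rcases isEmpty_or_nonempty ι with hι | hι
      · have : (fun x => (b x).repr (s x)) = fun _ => (0 : lp (fun _ : ι => ℂ) 2) := by
          funext x; ext i; exact hι.elim i
        rw [this]; exact aestronglyMeasurable_const
      · refine aestronglyMeasurable_of_tendsto_ae (u := Filter.atTop)
          (f := fun (F : Finset ι) x => ∑ i ∈ F, lp.single 2 i ((b x).repr (s x) i)) ?_ ?_
        · intro F
          refine Finset.aestronglyMeasurable_fun_sum _ fun i _ => ?_
          have hi : AEStronglyMeasurable (fun x => (b x).repr (s x) i) μ := by
            simpa only [HilbertBasis.repr_apply_apply] using (h i).aestronglyMeasurable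
          have hc : Continuous fun c : ℂ => (lp.single 2 i c : lp (fun _ : ι => ℂ) 2) :=
            (lp.isometry_single (p := 2) (E := fun _ : ι => ℂ) i).continuous
          exact hc.comp_aestronglyMeasurable hi
        · exact Filter.Eventually.of_forall fun x => hs x
    · intro h i
      have hc : Continuous fun v : lp (fun _ : ι => ℂ) 2 => v i :=
        (lp.evalCLM ℂ (fun _ : ι => ℂ) 2 i).continuous
      have := (hc.comp_aestronglyMeasurable h).aemeasurable
      simpa only [HilbertBasis.repr_apply_apply] using this
  unfold IsL2Section MemLp
  rw [hm, eLpNorm_lt_top_iff_lintegral_rpow_enorm_lt_top (by norm_num) (by norm_num)]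
  simp

/-- The space of square integrable sections, before identification of sections that agree almost
everywhere. -/
def l2Sections (b : ∀ x, HilbertBasis ι ℂ (H x)) (μ : Measure X) : Submodule ℂ (∀ x, H x) where
  carrier := {s | IsL2Section b μ s}
  zero_mem' := by
    rw [Set.mem_ofPred_eq, isL2Section_iff]
    simp
  add_mem' := by
    intro s t hs ht
    rw [Set.mem_ofPred_eq, isL2Section_iff] at *
    simp only [Pi.add_apply, map_add]
    exact hs.add ht
  smul_mem' := by
    intro c s hs
    rw [Set.mem_ofPred_eq, isL2Section_iff] at *
    simp only [Pi.smul_apply, map_smul]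
    exact hs.const_smul c

/-- The type of square integrable sections; it carries the seminorm of `∫ ⟪s x, t x⟫ dμ(x)` and not
the topology of pointwise convergence. -/
def L2Section (b : ∀ x, HilbertBasis ι ℂ (H x)) (μ : Measure X) : Type := l2Sections b μ

variable (b : ∀ x, HilbertBasis ι ℂ (H x)) (μ : Measure X)

instance : AddCommGroup (L2Section b μ) := inferInstanceAs (AddCommGroup (l2Sections b μ))

instance : Module ℂ (L2Section b μ) := inferInstanceAs (Module ℂ (l2Sections b μ))

variable {b μ}

/-- The value of a section at a point. -/
def L2Section.val (s : L2Section b μ) (x : X) : H x := s.1 x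

theorem L2Section.isL2 (s : L2Section b μ) : IsL2Section b μ s.val := s.2

/-- The coordinates of a section, as an element of `L²(X; ℓ²)`. -/
def L2Section.coords (s : L2Section b μ) : Lp (lp (fun _ : ι => ℂ) 2) 2 μ :=
  ((isL2Section_iff b μ s.val).1 s.isL2).toLp _

theorem L2Section.coeFn_coords (s : L2Section b μ) :
    s.coords =ᵐ[μ] fun x => (b x).repr (s.val x) := MemLp.coeFn_toLp _

theorem L2Section.coords_add (s t : L2Section b μ) : (s + t).coords = s.coords + t.coords := by
  refine Lp.ext ?_
  filter_upwards [(s + t).coeFn_coords, s.coeFn_coords, t.coeFn_coords,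
    Lp.coeFn_add s.coords t.coords] with x h1 h2 h3 h4
  rw [h1, h4, Pi.add_apply, h2, h3, ← map_add]
  rfl

theorem L2Section.coords_smul (c : ℂ) (s : L2Section b μ) : (c • s).coords = c • s.coords := by
  refine Lp.ext ?_
  filter_upwards [(c • s).coeFn_coords, s.coeFn_coords, Lp.coeFn_smul c s.coords] with x h1 h2 h3
  rw [h1, h3, Pi.smul_apply, h2, ← map_smul]
  rfl

theorem L2Section.inner_coords (s t : L2Section b μ) :
    inner ℂ s.coords t.coords = ∫ x, inner ℂ (s.val x) (t.val x) ∂μ := by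
  rw [L2.inner_def]
  refine integral_congr_ae ?_
  filter_upwards [s.coeFn_coords, t.coeFn_coords] with x h1 h2
  rw [h1, h2, LinearIsometryEquiv.inner_map_map]

/-- The semi-inner product `∫ ⟪s x, t x⟫ dμ(x)` on square integrable sections. -/
instance L2Section.core : PreInnerProductSpace.Core ℂ (L2Section b μ) where
  inner s t := ∫ x, inner ℂ (s.val x) (t.val x) ∂μ
  conj_inner_symm s t := by
    rw [← inner_coords, ← inner_coords]
    exact inner_conj_symm _ _
  re_inner_nonneg s := by
    rw [← inner_coords]
    exact inner_self_nonneg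
  add_left s t r := by
    rw [← inner_coords, ← inner_coords, ← inner_coords, coords_add]
    exact inner_add_left _ _ _
  smul_left s t c := by
    rw [← inner_coords, ← inner_coords, coords_smul]
    exact inner_smul_left _ _ _

instance : SeminormedAddCommGroup (L2Section b μ) :=
  InnerProductSpace.Core.toSeminormedAddCommGroup (𝕜 := ℂ)

instance : InnerProductSpace ℂ (L2Section b μ) := InnerProductSpace.ofCore L2Section.core

theorem L2Section.inner_def (s t : L2Section b μ) :
    inner ℂ s t = ∫ x, inner ℂ (s.val x) (t.val x) ∂μ := rfl

/-- The isometry from sections to `L²(X; ℓ²)`. -/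
def L2Section.coordsIsometry (b : ∀ x, HilbertBasis ι ℂ (H x)) (μ : Measure X) :
    L2Section b μ →ₗᵢ[ℂ] Lp (lp (fun _ : ι => ℂ) 2) 2 μ :=
  ({ toFun := L2Section.coords
     map_add' := L2Section.coords_add
     map_smul' := L2Section.coords_smul } :
    L2Section b μ →ₗ[ℂ] Lp (lp (fun _ : ι => ℂ) 2) 2 μ).isometryOfInner fun s t => by
      rw [L2Section.inner_def]
      exact L2Section.inner_coords s t

theorem L2Section.coordsIsometry_surjective :
    Function.Surjective (L2Section.coordsIsometry b μ) := by
  intro f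
  have hf : IsL2Section b μ (fun x => (b x).repr.symm (f x)) := by
    rw [isL2Section_iff]
    simpa using Lp.memLp f
  refine ⟨(⟨_, hf⟩ : l2Sections b μ), Lp.ext ?_⟩
  filter_upwards [L2Section.coeFn_coords (⟨_, hf⟩ : l2Sections b μ)] with x hx
  refine hx.trans ?_
  exact LinearIsometryEquiv.apply_symm_apply _ _

instance : CompleteSpace (L2Section b μ) :=
  ((L2Section.coordsIsometry b μ).isometry.isUniformInducing.completeSpace_congr
    L2Section.coordsIsometry_surjective).2 inferInstance

variable (b μ)

/-- The direct integral `∫^⊕ H x dμ(x)`: square integrable sections, modulo sections of norm zero,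
that is, modulo equality almost everywhere. -/
abbrev DirectIntegral : Type := SeparationQuotient (L2Section b μ)

variable {b μ}

variable {G : Type} [Group G]

/-- A field of unitary representations is measurable if every group element sends measurable
sections to measurable sections. -/
def IsMeasurableRepField (b : ∀ x, HilbertBasis ι ℂ (H x)) (μ : Measure X)
    (U : ∀ x, G →* (H x ≃ₗᵢ[ℂ] H x)) : Prop :=
  ∀ (g : G) (s : ∀ x, H x), IsMeasurableSection b μ s →
    IsMeasurableSection b μ fun x => U x g (s x)

variable {U : ∀ x, G →* (H x ≃ₗᵢ[ℂ] H x)}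

/-- The pointwise action `(g s)(x) = U x g (s x)` on square integrable sections. -/
def L2Section.act (hU : IsMeasurableRepField b μ U) (g : G) :
    L2Section b μ →ₗᵢ[ℂ] L2Section b μ :=
  ({ toFun := fun s => (⟨fun x => U x g (s.val x), hU g _ s.isL2.1, by
        simpa only [LinearIsometryEquiv.enorm_map] using s.isL2.2⟩ : l2Sections b μ)
     map_add' := fun s t => Subtype.ext (funext fun x => map_add (U x g) (s.val x) (t.val x))
     map_smul' := fun c s => Subtype.ext (funext fun x => map_smul (U x g) c (s.val x)) } :
    L2Section b μ →ₗ[ℂ] L2Section b μ).isometryOfInner fun s t => by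
      rw [L2Section.inner_def, L2Section.inner_def]
      exact integral_congr_ae (Filter.Eventually.of_forall fun x =>
        LinearIsometryEquiv.inner_map_map (U x g) (s.val x) (t.val x))

theorem L2Section.act_one (hU : IsMeasurableRepField b μ U) (s : L2Section b μ) :
    L2Section.act hU 1 s = s :=
  Subtype.ext (funext fun x => by
    change U x 1 (s.val x) = s.val x
    rw [map_one]; rfl)

theorem L2Section.act_mul (hU : IsMeasurableRepField b μ U) (g h : G) (s : L2Section b μ) :
    L2Section.act hU (g * h) s = L2Section.act hU g (L2Section.act hU h s) :=
  Subtype.ext (funext fun x => by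
    change U x (g * h) (s.val x) = U x g (U x h (s.val x))
    rw [map_mul]; rfl)

/-- The operator induced by `g` on the direct integral, `[s] ↦ [x ↦ U x g (s x)]`. -/
def DirectIntegral.act (hU : IsMeasurableRepField b μ U) (g : G) :
    DirectIntegral b μ →ₗᵢ[ℂ] DirectIntegral b μ where
  toFun := SeparationQuotient.lift (fun s => SeparationQuotient.mk (L2Section.act hU g s))
    fun _ _ h => SeparationQuotient.mk_eq_mk.2 (h.map (L2Section.act hU g).continuous)
  map_add' := by
    refine Quotient.ind₂ fun s t => ?_
    exact congrArg SeparationQuotient.mk (map_add (L2Section.act hU g) s t)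
  map_smul' := by
    intro c
    refine Quotient.ind fun s => ?_
    exact congrArg SeparationQuotient.mk (map_smul (L2Section.act hU g) c s)
  norm_map' := Quotient.ind fun s => (L2Section.act hU g).norm_map s

/-- The direct integral `∫^⊕ U x dμ(x)` of a measurable field of unitary representations of a
discrete group. -/
def DirectIntegral.rep (hU : IsMeasurableRepField b μ U) :
    G →* (DirectIntegral b μ ≃ₗᵢ[ℂ] DirectIntegral b μ) where
  toFun g :=
    { toLinearEquiv := LinearEquiv.ofLinearMap (DirectIntegral.act hU g).toLinearMap
        (DirectIntegral.act hU g⁻¹).toLinearMap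
        (LinearMap.ext (Quotient.ind fun s => congrArg SeparationQuotient.mk
          (show L2Section.act hU g (L2Section.act hU g⁻¹ s) = s by
            rw [← L2Section.act_mul, mul_inv_cancel, L2Section.act_one])))
        (LinearMap.ext (Quotient.ind fun s => congrArg SeparationQuotient.mk
          (show L2Section.act hU g⁻¹ (L2Section.act hU g s) = s by
            rw [← L2Section.act_mul, inv_mul_cancel, L2Section.act_one])))
      norm_map' := (DirectIntegral.act hU g).norm_map }
  map_one' := LinearIsometryEquiv.ext (Quotient.ind fun s =>
    congrArg SeparationQuotient.mk (L2Section.act_one hU s))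
  map_mul' g h := LinearIsometryEquiv.ext (Quotient.ind fun s =>
    congrArg SeparationQuotient.mk (L2Section.act_mul hU g h s))

theorem DirectIntegral.rep_mk (hU : IsMeasurableRepField b μ U) (g : G) (s : L2Section b μ) :
    DirectIntegral.rep hU g (SeparationQuotient.mk s) =
      SeparationQuotient.mk (L2Section.act hU g s) := rfl

end DirectIntegral

/-! ### The regular representation and the induced representations -/

/-- Right translation `(R(g) f)(h) = f(h g)` on `ℓ²(G)`. -/
def regAct {G : Type} [Group G] (g : G) (f : lp (fun _ : G => ℂ) 2) : lp (fun _ : G => ℂ) 2 :=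
  ⟨fun h => f (h * g), by
    have hp : 0 < (2 : ℝ≥0∞).toReal := by norm_num
    have h : Summable fun k => ‖f k‖ ^ (2 : ℝ≥0∞).toReal := (lp.memℓp f).summable hp
    exact memℓp_gen (h.comp_injective (mul_left_injective g))⟩

theorem regAct_apply {G : Type} [Group G] (g h : G) (f : lp (fun _ : G => ℂ) 2) :
    regAct g f h = f (h * g) := rfl

theorem regAct_mul {G : Type} [Group G] (g g' : G) (f : lp (fun _ : G => ℂ) 2) :
    regAct (g * g') f = regAct g (regAct g' f) := by
  refine lp.ext (funext fun h => ?_)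
  rw [regAct_apply, regAct_apply, regAct_apply, mul_assoc]

theorem regAct_one {G : Type} [Group G] (f : lp (fun _ : G => ℂ) 2) : regAct 1 f = f := by
  refine lp.ext (funext fun h => ?_)
  rw [regAct_apply, mul_one]

theorem norm_regAct {G : Type} [Group G] (g : G) (f : lp (fun _ : G => ℂ) 2) :
    ‖regAct g f‖ = ‖f‖ := by
  rw [lp.norm_eq_tsum_rpow (by norm_num), lp.norm_eq_tsum_rpow (by norm_num)]
  congr 1
  simp only [regAct_apply]
  exact (Equiv.mulRight g).tsum_eq fun h => ‖f h‖ ^ (2 : ℝ≥0∞).toReal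

/-- The right regular representation `R` of `G` on `ℓ²(G)`. -/
def rightRegular (G : Type) [Group G] :
    G →* (lp (fun _ : G => ℂ) 2 ≃ₗᵢ[ℂ] lp (fun _ : G => ℂ) 2) where
  toFun g :=
    { toFun := regAct g
      invFun := regAct g⁻¹
      map_add' := fun _ _ => rfl
      map_smul' := fun _ _ => rfl
      left_inv := fun f => by rw [← regAct_mul, inv_mul_cancel, regAct_one]
      right_inv := fun f => by rw [← regAct_mul, mul_inv_cancel, regAct_one]
      norm_map' := norm_regAct g }
  map_one' := LinearIsometryEquiv.ext regAct_one
  map_mul' g g' := LinearIsometryEquiv.ext (regAct_mul g g')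

instance (I : Type) [Nonempty I] : Nontrivial (lp (fun _ : I => ℂ) 2) := by
  classical
  have i : I := Classical.arbitrary I
  refine ⟨lp.single 2 i 1, 0, fun h => ?_⟩
  have := congrArg (fun f : lp (fun _ : I => ℂ) 2 => f i) h
  simp at this

/-- The functions `φ : G_a → ℂ` with `φ(b, k) = χ(b) φ(0, k)` and `∑ |φ(0, k)|² < ∞`. -/
def indSubmodule {a : ℝˣ} (χ : BDual a) : Submodule ℂ (GGrp a → ℂ) where
  carrier := {φ | (∀ b k, φ (GGrp.mk b k) = χ b * φ (GGrp.mk 1 k)) ∧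
    Memℓp (fun k : ℤ => φ (GGrp.mk 1 k)) 2}
  zero_mem' := ⟨fun b k => by simp, zero_memℓp⟩
  add_mem' := by
    rintro φ ψ ⟨h1, h2⟩ ⟨h3, h4⟩
    exact ⟨fun b k => by rw [Pi.add_apply, Pi.add_apply, h1, h3, mul_add], h2.add h4⟩
  smul_mem' := by
    rintro c φ ⟨h1, h2⟩
    exact ⟨fun b k => by
      rw [Pi.smul_apply, Pi.smul_apply, h1, smul_eq_mul, smul_eq_mul, mul_left_comm],
      h2.const_smul c⟩

/-- The space `H_χ^Ind`, with the norm `‖φ‖² = ∑ |φ(0, k)|²`. -/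
def IndSpace {a : ℝˣ} (χ : BDual a) : Type := indSubmodule χ

section Induced

variable {a : ℝˣ} {χ : BDual a}

instance : AddCommGroup (IndSpace χ) := inferInstanceAs (AddCommGroup (indSubmodule χ))

instance : Module ℂ (IndSpace χ) := inferInstanceAs (Module ℂ (indSubmodule χ))

/-- The function on `G_a` underlying an element of `H_χ^Ind`. -/
def IndSpace.val (φ : IndSpace χ) : GGrp a → ℂ := φ.1

theorem IndSpace.ext {φ ψ : IndSpace χ} (h : ∀ g, φ.val g = ψ.val g) : φ = ψ :=
  Subtype.ext (funext h)

theorem IndSpace.val_mk (φ : IndSpace χ) (b : BGrp a) (k : ℤ) :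
    φ.val (GGrp.mk b k) = χ b * φ.val (GGrp.mk 1 k) := φ.2.1 b k

/-- The identification of `H_χ^Ind` with `ℓ²(ℤ)` through `φ ↦ (φ(0, k))_k`. -/
def IndSpace.coordsEquiv (χ : BDual a) : IndSpace χ ≃ₗ[ℂ] lp (fun _ : ℤ => ℂ) 2 where
  toFun φ := ⟨fun k => φ.val (GGrp.mk 1 k), φ.2.2⟩
  map_add' _ _ := rfl
  map_smul' _ _ := rfl
  invFun ξ := (⟨fun g => χ g.left * ξ g.exp, fun b k => by
      change (χ b : ℂ) * ξ k = χ b * (χ (1 : BGrp a) * ξ k)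
      rw [map_one, Circle.coe_one, one_mul], by
      have h : (fun k : ℤ => (χ (1 : BGrp a) : ℂ) * ξ k) = ξ := by
        funext k; rw [map_one, Circle.coe_one, one_mul]
      change Memℓp (fun k : ℤ => (χ (1 : BGrp a) : ℂ) * ξ k) 2
      rw [h]
      exact lp.memℓp ξ⟩ : indSubmodule χ)
  left_inv φ := IndSpace.ext fun g => (φ.val_mk g.left g.exp).symm
  right_inv ξ := lp.ext (funext fun k => by
    change (χ (1 : BGrp a) : ℂ) * ξ k = ξ k
    rw [map_one, Circle.coe_one, one_mul])

instance : NormedAddCommGroup (IndSpace χ) :=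
  NormedAddCommGroup.induced (IndSpace χ) (lp (fun _ : ℤ => ℂ) 2) (IndSpace.coordsEquiv χ)
    (IndSpace.coordsEquiv χ).injective

instance : InnerProductSpace ℂ (IndSpace χ) where
  norm_smul_le c φ := by
    change ‖IndSpace.coordsEquiv χ (c • φ)‖ ≤ ‖c‖ * ‖IndSpace.coordsEquiv χ φ‖
    rw [map_smul, norm_smul]
  inner φ ψ := ∑' k : ℤ, inner ℂ (φ.val (GGrp.mk 1 k)) (ψ.val (GGrp.mk 1 k))
  norm_sq_eq_re_inner φ := norm_sq_eq_re_inner (𝕜 := ℂ) (IndSpace.coordsEquiv χ φ)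
  conj_inner_symm φ ψ :=
    inner_conj_symm (𝕜 := ℂ) (IndSpace.coordsEquiv χ φ) (IndSpace.coordsEquiv χ ψ)
  add_left φ ψ ρ := inner_add_left (𝕜 := ℂ) (IndSpace.coordsEquiv χ φ)
    (IndSpace.coordsEquiv χ ψ) (IndSpace.coordsEquiv χ ρ)
  smul_left φ ψ c :=
    inner_smul_left (𝕜 := ℂ) (IndSpace.coordsEquiv χ φ) (IndSpace.coordsEquiv χ ψ) c

theorem IndSpace.norm_sq_eq (φ : IndSpace χ) :
    ‖φ‖ ^ 2 = ∑' k : ℤ, ‖φ.val (GGrp.mk 1 k)‖ ^ 2 := by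
  have h := lp.norm_rpow_eq_tsum (p := 2) (by norm_num) (IndSpace.coordsEquiv χ φ)
  simp only [ENNReal.toReal_ofNat, Real.rpow_ofNat] at h
  exact h

/-- The same identification as an isometry. -/
def IndSpace.coordsIsometry (χ : BDual a) : IndSpace χ ≃ₗᵢ[ℂ] lp (fun _ : ℤ => ℂ) 2 :=
  { IndSpace.coordsEquiv χ with norm_map' := fun _ => rfl }

instance : CompleteSpace (IndSpace χ) :=
  (IndSpace.coordsIsometry χ).toIsometryEquiv.completeSpace_iff.2 inferInstance

instance : Nontrivial (IndSpace χ) := (IndSpace.coordsEquiv χ).toEquiv.nontrivial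

/-- Right translation `(π_χ^Ind(g) φ)(h) = φ(h g)` on `H_χ^Ind`. -/
def IndSpace.translate (g : GGrp a) (φ : IndSpace χ) : IndSpace χ :=
  (⟨fun h => φ.val (h * g), fun b k => by
      have h1 : GGrp.mk b k * g = GGrp.mk (b * BGrp.smul k g.left) (k + g.exp) := rfl
      have h2 : GGrp.mk 1 k * g = GGrp.mk (1 * BGrp.smul k g.left) (k + g.exp) := rfl
      change φ.val (GGrp.mk b k * g) = (χ b : ℂ) * φ.val (GGrp.mk 1 k * g)
      rw [h1, h2, φ.val_mk, φ.val_mk (1 * _), one_mul, map_mul, Circle.coe_mul, mul_assoc], by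
      refine (memℓp_gen_iff (by norm_num)).2 ?_
      have h := (memℓp_gen_iff (by norm_num)).1 φ.2.2
      refine ((Equiv.addRight g.exp).summable_iff.2 h).congr fun k => ?_
      have h2 : GGrp.mk 1 k * g = GGrp.mk (1 * BGrp.smul k g.left) (k + g.exp) := rfl
      change ‖φ.val (GGrp.mk 1 (k + g.exp))‖ ^ _ = ‖φ.val (GGrp.mk 1 k * g)‖ ^ _
      rw [h2, φ.val_mk (1 * _), norm_mul, Circle.norm_coe, one_mul]⟩ : indSubmodule χ)

theorem IndSpace.val_translate (g h : GGrp a) (φ : IndSpace χ) :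
    (IndSpace.translate g φ).val h = φ.val (h * g) := rfl

theorem IndSpace.norm_translate (g : GGrp a) (φ : IndSpace χ) :
    ‖IndSpace.translate g φ‖ = ‖φ‖ := by
  refine (sq_eq_sq₀ (norm_nonneg _) (norm_nonneg _)).1 ?_
  rw [IndSpace.norm_sq_eq, IndSpace.norm_sq_eq,
    ← (Equiv.addRight g.exp).tsum_eq fun k => ‖φ.val (GGrp.mk 1 k)‖ ^ 2]
  refine tsum_congr fun k => ?_
  have h2 : GGrp.mk 1 k * g = GGrp.mk (1 * BGrp.smul k g.left) (k + g.exp) := rfl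
  rw [IndSpace.val_translate, h2, φ.val_mk (1 * _), norm_mul, Circle.norm_coe, one_mul]
  rfl

/-- The induced representation `π_χ^Ind` of `G_a`. -/
def indRep (χ : BDual a) : GGrp a →* (IndSpace χ ≃ₗᵢ[ℂ] IndSpace χ) where
  toFun g :=
    { toFun := IndSpace.translate g
      invFun := IndSpace.translate g⁻¹
      map_add' := fun _ _ => rfl
      map_smul' := fun _ _ => rfl
      left_inv := fun φ => IndSpace.ext fun h => congrArg φ.val (inv_mul_cancel_right h g)
      right_inv := fun φ => IndSpace.ext fun h => congrArg φ.val (mul_inv_cancel_right h g)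
      norm_map' := IndSpace.norm_translate g }
  map_one' := LinearIsometryEquiv.ext fun φ => IndSpace.ext fun h => congrArg φ.val (mul_one h)
  map_mul' g g' := LinearIsometryEquiv.ext fun φ =>
    IndSpace.ext fun h => congrArg φ.val (mul_assoc h g g').symm

/-- The Hilbert basis `(e_k)` of `H_χ^Ind` with `e_k(b, l) = χ(b) δ_{k,l}`. These sections define
the measurable structure of the field `χ ↦ H_χ^Ind`. -/
def indBasis (χ : BDual a) : HilbertBasis ℤ ℂ (IndSpace χ) :=
  HilbertBasis.ofRepr (IndSpace.coordsIsometry χ)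

theorem inner_indBasis (χ : BDual a) (k : ℤ) (φ : IndSpace χ) :
    inner ℂ (indBasis χ k) φ = φ.val (GGrp.mk 1 k) := by
  rw [← HilbertBasis.repr_apply_apply]
  rfl

theorem continuous_eval (b : BGrp a) : Continuous fun χ : BDual a => ((χ b : Circle) : ℂ) :=
  continuous_subtype_val.comp
    (show Continuous fun χ : BGrp a →ₜ* Circle => χ b from continuous_eval_const b)

theorem measurable_indRep (a : ℝˣ) (μ : Measure (BDual a)) :
    IsMeasurableRepField indBasis μ (fun χ : BDual a => indRep χ) := by
  intro g s hs k
  have h2 : ∀ χ : BDual a, inner ℂ (indBasis χ k) (indRep χ g (s χ)) =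
      (χ (BGrp.smul k g.left) : ℂ) * inner ℂ (indBasis χ (k + g.exp)) (s χ) := by
    intro χ
    rw [inner_indBasis, inner_indBasis, ← IndSpace.val_mk]
    change (s χ).val (GGrp.mk (1 * BGrp.smul k g.left) (k + g.exp)) = _
    rw [one_mul]
  simp only [h2]
  exact (continuous_eval _).measurable.aemeasurable.mul (hs _)

end Induced

/-- `U_a = C*(G_a)`. -/
abbrev UAlg (a : ℝˣ) : Type 1 := GroupCStar (GGrp a)

/-- The induced representation `π_χ^Ind` as a representation of `U_a`. -/
def indCStarRep {a : ℝˣ} (χ : BDual a) : UAlg a →⋆ₐ[ℂ] (IndSpace χ →L[ℂ] IndSpace χ) :=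
  GroupCStar.lift (indRep χ)

/-- The set of unitary equivalence classes of induced representations of `U_a`. -/
def inducedClasses (a : ℝˣ) : Set (RepClass (UAlg a)) :=
  {c | ∃ χ : BDual a, c = repClass (indCStarRep χ)}

/-- The Hilbert space `∫^⊕ H_χ^Ind dμ(χ)` over the dual of `B_a` with its Haar measure. -/
abbrev IndIntegral (a : ℝˣ) : Type :=
  DirectIntegral (fun χ : BDual a => indBasis χ) (haarDual a)

theorem isL2Section_basis (a : ℝˣ) :
    IsL2Section (fun χ : BDual a => indBasis χ) (haarDual a) fun χ => indBasis χ 0 := by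
  refine ⟨fun i => ?_, ?_⟩
  · have h : ∀ χ : BDual a, inner ℂ (indBasis χ i) (indBasis χ 0) = if i = 0 then (1 : ℂ) else 0 :=
      fun χ => orthonormal_iff_ite.1 (indBasis χ).orthonormal i 0
    simp only [h]
    exact aemeasurable_const
  · have h : ∀ χ : BDual a, ‖indBasis χ 0‖ₑ = 1 := fun χ => by
      rw [← ofReal_norm, (indBasis χ).orthonormal.1 0, ENNReal.ofReal_one]
    have : IsFiniteMeasure (haarDual a) := by unfold haarDual; infer_instance
    simp only [h, one_pow, lintegral_const, one_mul]
    exact measure_lt_top _ _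

instance (a : ℝˣ) : Nontrivial (IndIntegral a) := by
  refine ⟨SeparationQuotient.mk (⟨_, isL2Section_basis a⟩ : l2Sections _ _), 0, fun h => ?_⟩
  have h1 := congrArg (fun v => inner ℂ v v) h
  have h2 : inner ℂ (SeparationQuotient.mk (⟨_, isL2Section_basis a⟩ : l2Sections _ _) :
      IndIntegral a) (SeparationQuotient.mk (⟨_, isL2Section_basis a⟩ : l2Sections _ _)) =
      ∫ χ : BDual a, inner ℂ (indBasis χ 0) (indBasis χ 0) ∂(haarDual a) := rfl
  have h3 : ∀ χ : BDual a, inner ℂ (indBasis χ 0) (indBasis χ 0) = (1 : ℂ) := fun χ => by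
    rw [inner_self_eq_norm_sq_to_K, (indBasis χ).orthonormal.1 0]; simp
  simp only [h2, h3, inner_zero_left] at h1
  have h4 : haarDual a Set.univ = 1 := by
    exact Measure.haarMeasure_self (K₀ := (⊤ : TopologicalSpace.PositiveCompacts (BDual a)))
  simp [Measure.real, h4] at h1

/-- The representation `∫^⊕ π_χ^Ind dμ(χ)` of `U_a`. -/
def indIntegralRep (a : ℝˣ) : UAlg a →⋆ₐ[ℂ] (IndIntegral a →L[ℂ] IndIntegral a) :=
  GroupCStar.lift (DirectIntegral.rep (measurable_indRep a (haarDual a)))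

/-- The right regular representation of `U_a` on `ℓ²(G_a)`. -/
def regularCStarRep (a : ℝˣ) :
    UAlg a →⋆ₐ[ℂ] (lp (fun _ : GGrp a => ℂ) 2 →L[ℂ] lp (fun _ : GGrp a => ℂ) 2) :=
  GroupCStar.lift (rightRegular (GGrp a))

/-- `L^∞(𝕋)` for the circle `𝕋 = ℝ/ℤ` with its Haar measure. -/
abbrev LInftyCircle : Type := Lp ℂ ∞ (AddCircle.haarAddCircle (T := (1 : ℝ)))

/-- The class in `L^∞(𝕋)` of a continuous function on the circle. -/
def contToLInfty (f : C(AddCircle (1 : ℝ), ℂ)) : LInftyCircle :=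
  ContinuousMap.toLp ∞ AddCircle.haarAddCircle ℂ f

end

/-! In the coordinates `φ(0, k)` the induced representation is a weighted shift: each `e_k` is a
joint eigenvector of `B_a` with character `χ ∘ α(k)`, and `ℤ` permutes the `e_k` by translation. A
unitary equivalence sends `e_0` to a joint eigenvector with the same character, so that character
occurs in the other list and the orbits agree; conversely, left translation by `(0, n)` intertwines
`χ` with `χ ∘ α(n)`. If `χ` is aperiodic the characters in the list are distinct, so an operator in
the commutant is diagonal, and translations make it scalar (`IsAperiodicPt.exists_eq_smul`).

If `χ` has exact period `q`, pass to `L²(𝕋)` by Fourier series. Commuting with translations makes an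
operator a multiplication; commuting with `B_a` confines the frequencies of the multiplier to `qℤ`.
The commutant thus consists of the multiplications by `f(q ·)` with `f` bounded
(`IsPeriodicPt.exists_periodicOp_eq`). Zero divisors among such `f` give invariant subspaces, and
density of trigonometric polynomials in `L²` gives generation by `C(𝕋)`
(`commutes_periodicOp_of_fourier`).

For the solenoid, a character of `B_a` is the same as a sequence `w_n = χ(a^n)` on the circle that
respects every integer relation between powers of `a`. The equations of `K_a` yield these relations
only after multiplication by a nonzero integer. On `S_a` this integer cancels: the defect is a
continuous function with values in a finite group of roots of unity, and `S_a` is connected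
(`Solenoid.eq_one_of_zpow_eq_one`). Conversely, characters land in the identity component because
the dual of the torsion-free group `B_a` is connected (`PontryaginDual.connectedComponent_one`).

For the regular representation, the sections `χ ↦ χ(c)⁻¹ e_k`, `(c, k) ∈ G_a`, form a Hilbert basis
of the direct integral by orthogonality and completeness of characters on a compact group, and `G_a`
permutes them as it permutes point masses in `ℓ²(G_a)`. Throughout, `GroupCStar.lift_intertwines`
reduces statements about the C*-algebra to statements about the group. -/

noncomputable section

/-! ### Connectedness of the dual of a torsion-free group -/

section Dual

variable {G : Type*} [CommGroup G] [TopologicalSpace G] [DiscreteTopology G]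

/-- The characters `g ↦ exp (i t φ(g))`, `t ∈ ℝ`, of a discrete group attached to an additive
real-valued function `φ`. -/
def PontryaginDual.expLine (φ : Additive G →+ ℝ) (t : ℝ) : PontryaginDual G :=
  ({ toFun := fun g => Circle.exp (t * φ (Additive.ofMul g))
     map_one' := by simp
     map_mul' := fun g h => by simp [mul_add, Circle.exp_add]
     continuous_toFun := continuous_of_discreteTopology } : G →ₜ* Circle)

theorem PontryaginDual.expLine_apply (φ : Additive G →+ ℝ) (t : ℝ) (g : G) :
    PontryaginDual.expLine φ t g = Circle.exp (t * φ (Additive.ofMul g)) := rfl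

/-- The dual of a discrete group is compact, so evaluation, a continuous injection into a Hausdorff
product, is a closed embedding. Hence the topology of the dual is that of pointwise convergence. -/
theorem PontryaginDual.isInducing_coe :
    Topology.IsInducing fun (χ : PontryaginDual G) (g : G) => χ g := by
  have h : Continuous fun (χ : PontryaginDual G) (g : G) => χ g :=
    continuous_pi fun g =>
      show Continuous fun χ : G →ₜ* Circle => χ g from ContinuousEvalConst.continuous_eval_const g
  exact (h.isClosedEmbedding fun χ χ' h => PontryaginDual.ext fun g => congrFun h g).isInducing

theorem PontryaginDual.continuous_expLine (φ : Additive G →+ ℝ) :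
    Continuous (PontryaginDual.expLine φ) := by
  refine PontryaginDual.isInducing_coe.continuous_iff.2 (continuous_pi fun g => ?_)
  change Continuous fun t : ℝ => Circle.exp (t * φ (Additive.ofMul g))
  fun_prop

theorem PontryaginDual.expLine_mem_connectedComponent (φ : Additive G →+ ℝ) (t : ℝ) :
    PontryaginDual.expLine φ t ∈ connectedComponent (1 : PontryaginDual G) := by
  have h1 : PontryaginDual.expLine φ 0 = 1 := PontryaginDual.ext fun g => by
    rw [PontryaginDual.expLine_apply, zero_mul, Circle.exp_zero]; rfl
  have h2 := isPreconnected_range (PontryaginDual.continuous_expLine φ)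
  exact h2.subset_connectedComponent ⟨0, h1⟩ ⟨t, rfl⟩

/-- The subgroup generated by `F` is finitely generated and torsion-free, hence free, so `χ` lifts
on it to a real-valued homomorphism: choose arguments on a basis. Divisibility of `ℝ` extends the
lift to all of `G`. -/
theorem PontryaginDual.exists_expLine_eq [IsMulTorsionFree G] (χ : PontryaginDual G)
    (F : Finset G) : ∃ φ : Additive G →+ ℝ, ∀ g ∈ F, PontryaginDual.expLine φ 1 g = χ g := by
  let M : Submodule ℤ (Additive G) := Submodule.span ℤ (Additive.ofMul '' (F : Set G))
  have : Module.Finite ℤ M :=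
    Module.Finite.iff_fg.2 (Submodule.fg_span (F.finite_toSet.image Additive.ofMul))
  let v := Module.Free.chooseBasis ℤ M
  let φ₀ : M →ₗ[ℤ] ℝ := v.constr ℤ fun i => Complex.arg (χ (v i : Additive G).toMul : ℂ)
  obtain ⟨φ, hφ⟩ := (Module.Baer.of_divisible ℝ).extension_property_addMonoidHom
    M.subtype.toAddMonoidHom Subtype.val_injective φ₀.toAddMonoidHom
  have hφ' : ∀ m : M, φ m = φ₀ m := fun m => DFunLike.congr_fun hφ m
  let e1 : M →ₗ[ℤ] Additive Circle :=
    (MonoidHom.toAdditive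
      ((PontryaginDual.expLine φ 1 : G →ₜ* Circle) : G →* Circle)).toIntLinearMap
      ∘ₗ M.subtype
  let e2 : M →ₗ[ℤ] Additive Circle :=
    (MonoidHom.toAdditive ((χ : G →ₜ* Circle) : G →* Circle)).toIntLinearMap ∘ₗ M.subtype
  have he : e1 = e2 := v.ext fun i => by
    change Additive.ofMul (Circle.exp (1 * φ (v i : Additive G))) =
      Additive.ofMul (χ (v i : Additive G).toMul)
    rw [hφ', v.constr_basis, one_mul, Circle.exp_arg]
  exact ⟨φ, fun g hg => congrArg Additive.toMul
    (LinearMap.congr_fun he ⟨Additive.ofMul g, Submodule.subset_span ⟨g, hg, rfl⟩⟩)⟩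

/-- The dual of a torsion-free discrete group is connected. -/
theorem PontryaginDual.connectedComponent_one [IsMulTorsionFree G] :
    connectedComponent (1 : PontryaginDual G) = Set.univ := by
  refine Set.eq_univ_of_forall fun χ => ?_
  -- The component is closed, so it is enough to meet every basic neighbourhood of `χ`; such a
  -- neighbourhood restricts only finitely many values.
  rw [← (isClosed_connectedComponent (x := (1 : PontryaginDual G))).closure_eq,
    PontryaginDual.isInducing_coe.closure_eq_preimage_closure_image]
  refine mem_closure_iff.2 fun o ho hχ => ?_
  obtain ⟨F, u, hu, hFu⟩ := isOpen_pi_iff.1 ho _ hχ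
  obtain ⟨φ, hφ⟩ := PontryaginDual.exists_expLine_eq χ F
  refine ⟨_, hFu fun g hg => ?_, Set.mem_image_of_mem _
    (PontryaginDual.expLine_mem_connectedComponent φ 1)⟩
  rw [hφ g hg]
  exact (hu g hg).2

end Dual

/-- A continuous circle-valued function on a connected space whose values are roots of unity of a
fixed order is constant. -/
theorem eq_of_forall_pow_eq_one {X : Type*} [TopologicalSpace X] [PreconnectedSpace X]
    {h : X → Circle} (hc : Continuous h) {N : ℕ} (hN : N ≠ 0) (hpow : ∀ x, h x ^ N = 1)
    (x y : X) : h x = h y := by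
  have hfin : Set.Finite {z : Circle | z ^ N = 1} := by
    refine Set.Finite.of_finite_image (f := fun z : Circle => (z : ℂ)) ?_
      Circle.coe_injective.injOn
    refine ((Polynomial.nthRootsFinset N (1 : ℂ)).finite_toSet).subset ?_
    rintro _ ⟨z, hz, rfl⟩
    rw [Finset.mem_coe, Polynomial.mem_nthRootsFinset (Nat.pos_of_ne_zero hN)]
    change z ^ N = 1 at hz
    rw [← Circle.coe_pow, hz, Circle.coe_one]
  have h1 : (Set.range h).Subsingleton :=
    hfin.countable.isTotallyDisconnected _ (by rintro _ ⟨x, rfl⟩; exact hpow x)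
      (isPreconnected_range hc)
  exact h1 ⟨x, rfl⟩ ⟨y, rfl⟩

/-! ### The group `B_a` -/

section BGrp

variable {a : ℝˣ}

/-- The inclusion of `B_a` in the real line. -/
def BGrp.valHom (a : ℝˣ) : BGrp a →* Multiplicative ℝ :=
  AddMonoidHom.toMultiplicative (BAdd a).subtype

theorem BGrp.toAdd_valHom (b : BGrp a) : (BGrp.valHom a b).toAdd = b.val := rfl

theorem BGrp.val_pow (b : BGrp a) (n : ℕ) : (b ^ n).val = n * b.val := by
  rw [← BGrp.toAdd_valHom, map_pow, toAdd_pow, BGrp.toAdd_valHom, nsmul_eq_mul]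

theorem BGrp.val_zpow (b : BGrp a) (n : ℤ) : (b ^ n).val = n * b.val := by
  rw [← BGrp.toAdd_valHom, map_zpow, toAdd_zpow, BGrp.toAdd_valHom, zsmul_eq_mul]

theorem BGrp.val_prod {ι : Type*} (s : Finset ι) (f : ι → BGrp a) :
    (∏ i ∈ s, f i).val = ∑ i ∈ s, (f i).val := by
  rw [← BGrp.toAdd_valHom, map_prod, toAdd_prod]
  rfl

theorem BGrp.val_generator (n : ℤ) : (BGrp.pow a n).val = (a : ℝ) ^ n := by
  change ((a ^ n : ℝˣ) : ℝ) = _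
  rw [Units.val_zpow_eq_zpow_val]

instance : IsMulTorsionFree (BGrp a) where
  pow_left_injective n hn b c h := BGrp.ext (by
    have h1 := congrArg BGrp.val h
    simp only [BGrp.val_pow] at h1
    exact mul_left_cancel₀ (Nat.cast_ne_zero.2 hn) h1)

theorem BGrp.smul_generator (m n : ℤ) : BGrp.smul m (BGrp.pow a n) = BGrp.pow a (m + n) :=
  BGrp.ext (by
    rw [BGrp.val_smul, BGrp.val_generator, BGrp.val_generator, zpow_add₀ a.ne_zero,
      Units.val_zpow_eq_zpow_val])

/-- The free presentation `∑ mₙ [n] ↦ ∑ mₙ aⁿ` of `B_a`. -/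
def BGrp.presentation (a : ℝˣ) : (ℤ →₀ ℤ) →+ Additive (BGrp a) :=
  (Finsupp.linearCombination ℤ fun n => Additive.ofMul (BGrp.pow a n)).toAddMonoidHom

theorem BGrp.presentation_surjective : Function.Surjective (BGrp.presentation a) := by
  rintro ⟨x, hx⟩
  induction hx using AddSubgroup.closure_induction with
  | mem x hx =>
    obtain ⟨n, rfl⟩ := hx
    refine ⟨Finsupp.single n 1, ?_⟩
    change Finsupp.linearCombination ℤ _ _ = _
    rw [Finsupp.linearCombination_single, one_smul]
    rfl
  | zero => exact ⟨0, map_zero _⟩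
  | add x y hx hy ihx ihy =>
    obtain ⟨f, hf⟩ := ihx
    obtain ⟨g, hg⟩ := ihy
    exact ⟨f + g, by rw [map_add, hf, hg]; rfl⟩
  | neg x hx ih =>
    obtain ⟨f, hf⟩ := ih
    exact ⟨-f, by rw [map_neg, hf]; rfl⟩

theorem BGrp.toMul_presentation (f : ℤ →₀ ℤ) :
    (BGrp.presentation a f).toMul = ∏ n ∈ f.support, BGrp.pow a n ^ f n := by
  change Additive.toMul (Finsupp.linearCombination ℤ (fun n => Additive.ofMul (BGrp.pow a n)) f) = _
  rw [Finsupp.linearCombination_apply, Finsupp.sum, toMul_sum]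
  rfl

theorem BGrp.val_presentation (f : ℤ →₀ ℤ) :
    (BGrp.presentation a f).toMul.val = f.sum fun n c => c * (a : ℝ) ^ n := by
  rw [BGrp.toMul_presentation, BGrp.val_prod]
  exact Finset.sum_congr rfl fun n _ => by rw [BGrp.val_zpow, BGrp.val_generator]

theorem BDual.ext_generator {χ χ' : BDual a} (h : ∀ n, χ (BGrp.pow a n) = χ' (BGrp.pow a n)) :
    χ = χ' := by
  refine PontryaginDual.ext fun b => ?_
  obtain ⟨f, hf⟩ := BGrp.presentation_surjective (Additive.ofMul b)
  have hb : b = (BGrp.presentation a f).toMul := by rw [hf, toMul_ofMul]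
  rw [hb, BGrp.toMul_presentation, map_prod, map_prod]
  exact Finset.prod_congr rfl fun n _ => by rw [map_zpow, map_zpow, h]

/-- A sequence of points of the circle that satisfies all relations between powers of `a` comes
from a character of `B_a`. -/
theorem BDual.exists_of_relations (w : ℤ → Circle)
    (hw : ∀ f : ℤ →₀ ℤ, (f.sum fun n c => c * (a : ℝ) ^ n) = 0 →
      (f.sum fun n c => c • Additive.ofMul (w n)) = 0) :
    ∃ χ : BDual a, ∀ n, χ (BGrp.pow a n) = w n := by
  let θ : (ℤ →₀ ℤ) →+ Additive Circle :=
    (Finsupp.linearCombination ℤ fun n => Additive.ofMul (w n)).toAddMonoidHom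
  -- The hypothesis on `w` says exactly that `θ` kills the relations of the presentation, so `θ`
  -- descends to `B_a`.
  have hker : (BGrp.presentation a).ker ≤ θ.ker := fun f hf => by
    refine hw f ?_
    rw [← BGrp.val_presentation, (AddMonoidHom.mem_ker).1 hf]
    rfl
  let χ₀ : Additive (BGrp a) →+ Additive Circle :=
    (BGrp.presentation a).liftOfSurjective BGrp.presentation_surjective ⟨θ, hker⟩
  have hχ : ∀ f, χ₀ (BGrp.presentation a f) = θ f := fun f =>
    AddMonoidHom.liftOfRightInverse_comp_apply _ _ _ ⟨θ, hker⟩ f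
  refine ⟨({ toMonoidHom := MonoidHom.toAdditive.symm χ₀
             continuous_toFun := continuous_of_discreteTopology } : BGrp a →ₜ* Circle), fun n => ?_⟩
  have h1 := hχ (Finsupp.single n 1)
  have h2 : BGrp.presentation a (Finsupp.single n 1) = Additive.ofMul (BGrp.pow a n) := by
    change Finsupp.linearCombination ℤ _ _ = _
    rw [Finsupp.linearCombination_single, one_smul]
  have h3 : θ (Finsupp.single n 1) = Additive.ofMul (w n) := by
    change Finsupp.linearCombination ℤ _ _ = _
    rw [Finsupp.linearCombination_single, one_smul]
  rw [h2, h3] at h1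
  exact congrArg Additive.toMul h1

end BGrp

/-! ### The polynomial `Q_a` -/

section IntMinpoly

variable {a : ℝ}

theorem commonDen_ne_zero (p : Polynomial ℚ) : commonDen p ≠ 0 :=
  Finset.lcm_ne_zero_iff.2 fun i _ => (p.coeff i).den_ne_zero

theorem intMinpoly_ne_zero (ha : IsAlgebraic ℚ a) : intMinpoly a ≠ 0 := fun h => by
  have h1 := map_intMinpoly a
  rw [h, Polynomial.map_zero] at h1
  rcases mul_eq_zero.1 h1.symm with h2 | h2
  · exact commonDen_ne_zero _ (by exact_mod_cast Polynomial.C_eq_zero.1 h2)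
  · exact minpoly.ne_zero ha.isIntegral h2

theorem aeval_intMinpoly : Polynomial.aeval a (intMinpoly a) = 0 := by
  have h1 : Polynomial.aeval a ((intMinpoly a).map (Int.castRingHom ℚ)) =
      Polynomial.aeval a (intMinpoly a) := Polynomial.aeval_map_algebraMap ℚ a (intMinpoly a)
  rw [← h1, map_intMinpoly, map_mul, minpoly.aeval, mul_zero]

theorem polyDeg_pos (ha : IsAlgebraic ℚ a) : 0 < polyDeg a := by
  have h1 : ((intMinpoly a).map (Int.castRingHom ℚ)).natDegree = (intMinpoly a).natDegree :=
    Polynomial.natDegree_map_eq_of_injective (Int.cast_injective) _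
  rw [map_intMinpoly, Polynomial.natDegree_C_mul
    (by exact_mod_cast commonDen_ne_zero (minpoly ℚ a))] at h1
  rw [polyDeg, ← h1]
  exact minpoly.natDegree_pos ha.isIntegral

theorem leadingCoeff_intMinpoly_ne_zero (ha : IsAlgebraic ℚ a) :
    (intMinpoly a).coeff (polyDeg a) ≠ 0 :=
  Polynomial.leadingCoeff_ne_zero.2 (intMinpoly_ne_zero ha)

/-- Every integer polynomial that vanishes at `a` has a nonzero multiple divisible by `Q_a`. -/
theorem exists_mul_eq_intMinpoly_mul {p : Polynomial ℤ} (hp : Polynomial.aeval a p = 0) :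
    ∃ (N : ℤ) (g : Polynomial ℤ), N ≠ 0 ∧ Polynomial.C N * p = intMinpoly a * g := by
  have hinj : Function.Injective (Polynomial.map (Int.castRingHom ℚ)) :=
    Polynomial.map_injective _ Int.cast_injective
  obtain ⟨g₀, hg₀⟩ : minpoly ℚ a ∣ p.map (Int.castRingHom ℚ) :=
    minpoly.dvd ℚ a ((Polynomial.aeval_map_algebraMap ℚ a p).trans hp)
  obtain ⟨b, hb, hb'⟩ := IsLocalization.integerNormalization_spec (nonZeroDivisors ℤ) g₀
  -- `commonDen` turns the minimal polynomial into `Q_a` and `b` clears the denominators of the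
  -- cofactor. The extra integer is harmless, since connectedness cancels it later; no Gauss lemma
  -- is needed.
  refine ⟨commonDen (minpoly ℚ a) * b, IsLocalization.integerNormalization (nonZeroDivisors ℤ) g₀,
    mul_ne_zero (by exact_mod_cast commonDen_ne_zero (minpoly ℚ a)) (nonZeroDivisors.ne_zero hb),
    hinj ?_⟩
  have hb'' : (IsLocalization.integerNormalization (nonZeroDivisors ℤ) g₀).map
      (Int.castRingHom ℚ) = Polynomial.C (b : ℚ) * g₀ := by
    rw [← Polynomial.smul_eq_C_mul, Int.cast_smul_eq_zsmul]
    exact hb'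
  rw [Polynomial.map_mul, Polynomial.map_mul, map_intMinpoly, hb'', hg₀, Polynomial.map_C]
  simp only [eq_intCast, Int.cast_natCast, map_mul]
  ring

end IntMinpoly

/-! ### The shift module of sequences -/

section SeqShift

variable {A : Type*} [AddCommGroup A]

/-- The shift of two-sided sequences as a linear endomorphism. -/
def seqShift (A : Type*) [AddCommGroup A] : Module.End ℤ (ℤ → A) where
  toFun w k := w (k + 1)
  map_add' _ _ := rfl
  map_smul' _ _ := rfl

theorem seqShift_pow_apply (j : ℕ) (w : ℤ → A) (k : ℤ) : (seqShift A ^ j) w k = w (k + j) := by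
  induction j generalizing k with
  | zero => simp
  | succ j ih =>
    rw [pow_succ', Module.End.mul_apply]
    change (seqShift A ^ j) w (k + 1) = _
    rw [ih]
    congr 1
    push_cast
    ring

theorem aeval_seqShift_monomial_apply (c : ℤ) (j : ℕ) (w : ℤ → A) (k : ℤ) :
    Polynomial.aeval (seqShift A) (Polynomial.monomial j c) w k = c • w (k + j) := by
  rw [Polynomial.aeval_monomial, Module.End.mul_apply, Module.algebraMap_end_apply,
    Pi.smul_apply, seqShift_pow_apply]

/-- Sequences form a `ℤ[x]`-module with `x` acting as the shift, so relations between translates can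
be derived by polynomial divisibility. -/
theorem aeval_seqShift_apply (p : Polynomial ℤ) (w : ℤ → A) (k : ℤ) :
    Polynomial.aeval (seqShift A) p w k =
      ∑ j ∈ Finset.range (p.natDegree + 1), p.coeff j • w (k + j) := by
  conv_lhs => rw [p.as_sum_range]
  rw [map_sum, LinearMap.sum_apply, Finset.sum_apply]
  exact Finset.sum_congr rfl fun j _ => aeval_seqShift_monomial_apply _ _ _ _

end SeqShift

/-! ### The solenoid -/

section SolenoidSection

variable {a : ℝ}

instance (a : ℝ) : ConnectedSpace (Solenoid a) :=
  isConnected_iff_connectedSpace.1 (isConnected_connectedComponent (x := (1 : KGrp a)))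

theorem Solenoid.continuous_coord (k : ℤ) (i : Fin (polyDeg a)) :
    Continuous fun z : Solenoid a => z.coord k i :=
  (continuous_apply i).comp ((continuous_apply k).comp
    (continuous_subtype_val.comp continuous_subtype_val))

theorem Solenoid.coord_one (k : ℤ) (i : Fin (polyDeg a)) : (1 : Solenoid a).coord k i = 1 := rfl

theorem Solenoid.ext {y z : Solenoid a} (h : ∀ k i, y.coord k i = z.coord k i) : y = z :=
  Subtype.ext (Subtype.ext (funext fun k => funext fun i => h k i))

/-- Connectedness of `S_a` confines `h` to one root of unity. This is the device that cancels a
nonzero integer factor in a relation between coordinates. -/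
theorem Solenoid.eq_one_of_zpow_eq_one {h : Solenoid a → Circle} (hc : Continuous h) {N : ℤ}
    (hN : N ≠ 0) (hpow : ∀ z, h z ^ N = 1) (h1 : h 1 = 1) (z : Solenoid a) : h z = 1 := by
  rw [← h1]
  exact eq_of_forall_pow_eq_one hc (Int.natAbs_ne_zero.2 hN)
    (fun x => pow_natAbs_eq_one.2 (hpow x)) z 1

theorem companion_of_add_one_eq {i j : Fin (polyDeg a)} (h : (i : ℕ) + 1 = polyDeg a) :
    companion a i j = -(intMinpoly a).coeff j := by
  rw [companion, Matrix.of_apply, if_pos h]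

theorem prod_zpow_companion {w : Fin (polyDeg a) → Circle} {i j : Fin (polyDeg a)}
    (h : (j : ℕ) = i + 1) :
    ∏ l, w l ^ companion a i l = w j ^ (intMinpoly a).coeff (polyDeg a) := by
  have hi : (i : ℕ) + 1 ≠ polyDeg a := by have := j.2; omega
  rw [Finset.prod_eq_single j]
  · rw [companion, Matrix.of_apply, if_neg hi, if_pos h]
  · intro l _ hl
    rw [companion, Matrix.of_apply, if_neg hi, if_neg, zpow_zero]
    exact fun hl' => hl (Fin.ext (hl'.trans h.symm))
  · exact fun hj => (hj (Finset.mem_univ _)).elim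

/-- A row of `A_a` other than the last gives the `q_d`-th power of this identity; the exponent is
cancelled on the connected group. -/
theorem Solenoid.coord_add_one (ha : IsAlgebraic ℚ a) (z : Solenoid a) (k : ℤ)
    {i j : Fin (polyDeg a)} (h : (j : ℕ) = i + 1) : z.coord (k + 1) i = z.coord k j := by
  refine div_eq_one.1 (Solenoid.eq_one_of_zpow_eq_one
    (h := fun z => z.coord (k + 1) i / z.coord k j)
    ((Solenoid.continuous_coord _ _).div' (Solenoid.continuous_coord _ _))
    (leadingCoeff_intMinpoly_ne_zero ha) (fun y => ?_) ?_ z)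
  · rw [div_zpow, div_eq_one, ← prod_zpow_companion (w := y.coord k) h]
    exact y.1.2 k i
  · simp only [Solenoid.coord_one, div_one]

/-- The sequence `k ↦ z_k^{(1)}` of first coordinates of a point of the solenoid. -/
def Solenoid.seq (ha : IsAlgebraic ℚ a) (z : Solenoid a) (k : ℤ) : Additive Circle :=
  Additive.ofMul (z.coord k ⟨0, polyDeg_pos ha⟩)

theorem Solenoid.coord_eq_seq (ha : IsAlgebraic ℚ a) (z : Solenoid a) (k : ℤ)
    (i : Fin (polyDeg a)) : z.coord k i = (z.seq ha (k + (i : ℕ))).toMul := by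
  obtain ⟨i, hi⟩ := i
  induction i generalizing k with
  | zero => simp [Solenoid.seq]
  | succ i ih =>
    rw [← Solenoid.coord_add_one ha z k (i := ⟨i, by omega⟩) rfl, ih]
    congr 2
    push_cast
    ring

/-- The last row of `A_a` is this relation: its left side, at time `k + 1` and index `d - 1`,
supplies the leading term at `k + d`. -/
theorem Solenoid.aeval_intMinpoly_seq (ha : IsAlgebraic ℚ a) (z : Solenoid a) :
    Polynomial.aeval (seqShift (Additive Circle)) (intMinpoly a) (z.seq ha) = 0 := by
  funext k
  have hd := polyDeg_pos ha
  let i : Fin (polyDeg a) := ⟨polyDeg a - 1, by omega⟩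
  have h1 := z.1.2 k i
  have h2 : ∀ j, (z : KGrp a).1 k j = (z.seq ha (k + (j : ℕ))).toMul := z.coord_eq_seq ha k
  have h3 : (z : KGrp a).1 (k + 1) i = (z.seq ha (k + polyDeg a)).toMul := by
    refine (z.coord_eq_seq ha (k + 1) i).trans ?_
    congr 2
    have : ((polyDeg a - 1 : ℕ) : ℤ) = polyDeg a - 1 := by omega
    change k + 1 + ((polyDeg a - 1 : ℕ) : ℤ) = _
    rw [this]
    ring
  simp only [h2, h3, companion_of_add_one_eq (show (i : ℕ) + 1 = polyDeg a by simp only [i]; omega)]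
    at h1
  rw [aeval_seqShift_apply, Finset.sum_range_succ, Finset.sum_range, ← polyDeg]
  refine Additive.toMul.injective ?_
  rw [toMul_add, toMul_sum]
  simp only [toMul_zsmul]
  rw [h1, ← Finset.prod_mul_distrib]
  exact Finset.prod_eq_one fun j _ => by rw [zpow_neg, mul_inv_cancel]

/-- Some nonzero multiple `N p` is divisible by `Q_a`, so `p` of the shift gives `N`-torsion at each
time. This value depends continuously on `z` and is trivial at the identity, so it is trivial. -/
theorem Solenoid.aeval_seq_eq_zero (ha : IsAlgebraic ℚ a) {p : Polynomial ℤ}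
    (hp : Polynomial.aeval a p = 0) (z : Solenoid a) :
    Polynomial.aeval (seqShift (Additive Circle)) p (z.seq ha) = 0 := by
  funext k
  obtain ⟨N, g, hN, hg⟩ := exists_mul_eq_intMinpoly_mul hp
  refine congrArg Additive.ofMul (Solenoid.eq_one_of_zpow_eq_one (a := a)
    (h := fun z => Additive.toMul
      (Polynomial.aeval (seqShift (Additive Circle)) p (z.seq ha) k)) ?_ hN (fun y => ?_) ?_ z)
  · simp only [aeval_seqShift_apply, toMul_sum, toMul_zsmul]
    exact continuous_finsetProd _ fun j _ => (Solenoid.continuous_coord _ _).zpow _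
  · have h1 : N • Polynomial.aeval (seqShift (Additive Circle)) p (y.seq ha) = 0 := by
      have h2 : N • Polynomial.aeval (seqShift (Additive Circle)) p (y.seq ha) =
          Polynomial.aeval (seqShift (Additive Circle)) (Polynomial.C N * p) (y.seq ha) := by
        rw [map_mul, Polynomial.aeval_C, Module.End.mul_apply, Module.algebraMap_end_apply]
      rw [h2, hg, mul_comm, map_mul, Module.End.mul_apply, Solenoid.aeval_intMinpoly_seq, map_zero]
    exact congrArg Additive.toMul (congrFun h1 k)
  · have h1 : (1 : Solenoid a).seq ha = 0 := rfl
    rw [h1, map_zero]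
    rfl

end SolenoidSection

/-! ### The dual of `B_a` as the solenoid -/

section DualSolenoid

variable {a : ℝˣ}

theorem Solenoid.exists_character (ha : IsAlgebraic ℚ (a : ℝ)) (z : Solenoid (a : ℝ)) :
    ∃ χ : BDual a, ∀ k i, z.coord k i = χ (BGrp.pow a (k + (i : ℕ))) := by
  obtain ⟨χ, hχ⟩ := BDual.exists_of_relations (a := a) (fun n => (z.seq ha n).toMul) fun f hf => by
    -- Negative exponents are removed by the factor `a^(-N)`, with `N` a lower bound of the
    -- exponents; evaluating the shifted polynomial relation at time `N` recovers the original one.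
    obtain ⟨N, hN⟩ : ∃ N : ℤ, ∀ n ∈ f.support, N ≤ n := by
      obtain ⟨N, hN⟩ := f.support.bddBelow
      exact ⟨N, fun n hn => hN hn⟩
    have hcast : ∀ n ∈ f.support, ((n - N).toNat : ℤ) = n - N := fun n hn =>
      Int.toNat_of_nonneg (sub_nonneg.2 (hN n hn))
    let p : Polynomial ℤ := ∑ n ∈ f.support, Polynomial.monomial (n - N).toNat (f n)
    have hp : Polynomial.aeval (a : ℝ) p = 0 := by
      have h1 : Polynomial.aeval (a : ℝ) p =
          (a : ℝ) ^ (-N) * f.sum fun n c => c * (a : ℝ) ^ n := by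
        rw [map_sum, Finsupp.sum, Finset.mul_sum]
        refine Finset.sum_congr rfl fun n hn => ?_
        rw [Polynomial.aeval_monomial, ← zpow_natCast, hcast n hn, sub_eq_add_neg,
          zpow_add₀ a.ne_zero]
        simp only [algebraMap_int_eq, eq_intCast]
        ring
      rw [h1, hf, mul_zero]
    have h2 := congrFun (z.aeval_seq_eq_zero ha hp) N
    rw [map_sum, LinearMap.sum_apply, Finset.sum_apply, Pi.zero_apply] at h2
    rw [← h2]
    refine Finset.sum_congr rfl fun n hn => ?_
    rw [aeval_seqShift_monomial_apply, hcast n hn, add_sub_cancel]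
    rfl
  exact ⟨χ, fun k i => by rw [hχ, z.coord_eq_seq ha]⟩

/-- In the last row this is `χ` applied to `a^k Q_a(a) = 0`; in the other rows both sides are the
`q_d`-th power of one value. -/
theorem BDual.relation (χ : BDual a) (k : ℤ) (i : Fin (polyDeg (a : ℝ))) :
    χ (BGrp.pow a (k + 1 + (i : ℕ))) ^ (intMinpoly (a : ℝ)).coeff (polyDeg (a : ℝ)) =
      ∏ j, χ (BGrp.pow a (k + (j : Fin (polyDeg (a : ℝ))).1)) ^ companion (a : ℝ) i j := by
  by_cases hi : (i : ℕ) + 1 = polyDeg (a : ℝ)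
  · simp only [companion_of_add_one_eq hi, ← map_zpow, ← map_prod]
    congr 1
    refine BGrp.ext ?_
    have h1 := aeval_intMinpoly (a := (a : ℝ))
    rw [Polynomial.aeval_eq_sum_range, Finset.sum_range_succ, Finset.sum_range, ← polyDeg] at h1
    have h2 : k + 1 + ((i : ℕ) : ℤ) = k + (polyDeg (a : ℝ) : ℕ) := by omega
    rw [BGrp.val_prod]
    simp only [BGrp.val_zpow, BGrp.val_generator, h2, zpow_add₀ a.ne_zero, zpow_natCast]
    simp only [zsmul_eq_mul] at h1
    rw [mul_left_comm, ← neg_eq_of_add_eq_zero_right h1, mul_neg, Finset.mul_sum,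
      ← Finset.sum_neg_distrib]
    refine Finset.sum_congr rfl fun j _ => ?_
    push_cast
    ring
  · rw [prod_zpow_companion (w := fun j : Fin (polyDeg (a : ℝ)) => χ (BGrp.pow a (k + (j : ℕ))))
      (j := ⟨i + 1, by have := i.2; omega⟩) rfl]
    congr 3
    push_cast
    ring

/-- The homomorphism `χ ↦ (χ(a^{k+i}))` from the dual of `B_a` to `K_a`. -/
def BDual.toKGrp (a : ℝˣ) : BDual a →* KGrp (a : ℝ) where
  toFun χ := ⟨fun k i => χ (BGrp.pow a (k + (i : ℕ))), fun k i => χ.relation k i⟩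
  map_one' := rfl
  map_mul' _ _ := rfl

theorem BDual.continuous_apply (b : BGrp a) : Continuous fun χ : BDual a => χ b :=
  show Continuous fun χ : BGrp a →ₜ* Circle => χ b from
    ContinuousEvalConst.continuous_eval_const b

theorem BDual.continuous_toKGrp : Continuous (BDual.toKGrp a) :=
  continuous_induced_rng.2 (continuous_pi fun k => continuous_pi fun i =>
    BDual.continuous_apply (BGrp.pow a (k + (i : ℕ))))

/-- `B_a` is torsion-free, so its dual is connected and its continuous image through the identity
stays in the identity component. -/
theorem BDual.toKGrp_mem (χ : BDual a) :
    BDual.toKGrp a χ ∈ Subgroup.connectedComponentOfOne (KGrp (a : ℝ)) := by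
  have h := BDual.continuous_toKGrp.image_connectedComponent_subset (1 : BDual a)
  rw [PontryaginDual.connectedComponent_one, map_one] at h
  exact h ⟨χ, trivial, rfl⟩

/-- The homomorphism from the dual of `B_a` to the solenoid. -/
def BDual.toSolenoid (a : ℝˣ) : BDual a →* Solenoid (a : ℝ) :=
  (BDual.toKGrp a).codRestrict _ BDual.toKGrp_mem

theorem BDual.coord_toSolenoid (χ : BDual a) (k : ℤ) (i : Fin (polyDeg (a : ℝ))) :
    (BDual.toSolenoid a χ).coord k i = χ (BGrp.pow a (k + (i : ℕ))) := rfl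

theorem BDual.bijective_toSolenoid (ha : IsAlgebraic ℚ (a : ℝ)) :
    Function.Bijective (BDual.toSolenoid a) := by
  constructor
  · intro χ χ' h
    refine BDual.ext_generator fun n => ?_
    have h1 := congrArg (fun z : Solenoid (a : ℝ) => z.coord n ⟨0, polyDeg_pos ha⟩) h
    simpa only [BDual.coord_toSolenoid, Nat.cast_zero, add_zero] using h1
  · intro z
    obtain ⟨χ, hχ⟩ := z.exists_character ha
    exact ⟨χ, Solenoid.ext fun k i => (hχ k i).symm⟩

/-- The topological isomorphism from the dual of `B_a` to the solenoid. -/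
def BDual.solenoidEquiv (ha : IsAlgebraic ℚ (a : ℝ)) : BDual a ≃ₜ* Solenoid (a : ℝ) :=
  ContinuousMulEquiv.mk' (Continuous.homeoOfEquivCompactToT2
    (f := Equiv.ofBijective _ (BDual.bijective_toSolenoid ha))
    (BDual.continuous_toKGrp.subtype_mk _)) fun χ χ' => map_mul (BDual.toSolenoid a) χ χ'

theorem BDual.coord_solenoidEquiv (ha : IsAlgebraic ℚ (a : ℝ)) (χ : BDual a) (k : ℤ)
    (i : Fin (polyDeg (a : ℝ))) :
    (BDual.solenoidEquiv ha χ).coord k i = χ (BGrp.pow a (k + (i : ℕ))) := rfl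

theorem BDual.solenoidEquiv_dualAut (ha : IsAlgebraic ℚ (a : ℝ)) (χ : BDual a) :
    BDual.solenoidEquiv ha (dualAut a χ) = shift (a : ℝ) (BDual.solenoidEquiv ha χ) := by
  refine Solenoid.ext fun k i => ?_
  change (dualAut a χ) (BGrp.pow a _) = χ (BGrp.pow a _)
  change χ (BGrp.smul 1 (BGrp.pow a _)) = _
  rw [BGrp.smul_generator]
  congr 2
  ring

end DualSolenoid

/-! ### Intertwining operators of extended representations -/

section Intertwining

theorem star_coe_isometryEquiv {H : Type*} [NormedAddCommGroup H] [InnerProductSpace ℂ H]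
    [CompleteSpace H] (V : H ≃ₗᵢ[ℂ] H) :
    star ((V : H ≃L[ℂ] H) : H →L[ℂ] H) = ((V.symm : H ≃L[ℂ] H) : H →L[ℂ] H) :=
  LinearIsometryEquiv.adjoint_eq_symm V

variable {G : Type} [Group G] {H K : Type}
  [NormedAddCommGroup H] [InnerProductSpace ℂ H] [CompleteSpace H] [Nontrivial H]
  [NormedAddCommGroup K] [InnerProductSpace ℂ K] [CompleteSpace K] [Nontrivial K]

/-- An operator that intertwines two unitary representations intertwines their extensions to the
group C*-algebra. -/
theorem GroupCStar.lift_intertwines {U : G →* (H ≃ₗᵢ[ℂ] H)} {V : G →* (K ≃ₗᵢ[ℂ] K)}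
    (W : H →L[ℂ] K) (hW : ∀ g ξ, W (U g ξ) = V g (W ξ)) (x : GroupCStar G) (ξ : H) :
    W (GroupCStar.lift U x ξ) = GroupCStar.lift V x (W ξ) := by
  let πU : UnitaryRep G := { H := H, U := U }
  let πV : UnitaryRep G := { H := K, U := V }
  let f : UniversalProduct G → (H →L[ℂ] K) := fun y => W ∘L (show H →L[ℂ] H from y πU)
  let f' : UniversalProduct G → (H →L[ℂ] K) := fun y => (show K →L[ℂ] K from y πV) ∘L W
  have hf : Continuous f := (ContinuousLinearMap.compL ℂ H H K W).continuous.comp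
    (lp.evalCLM ℂ (fun π : UnitaryRep G => π.H →L[ℂ] π.H) ∞ πU).continuous
  have hf' : Continuous f' := ((ContinuousLinearMap.compL ℂ H K K).flip W).continuous.comp
    (lp.evalCLM ℂ (fun π : UnitaryRep G => π.H →L[ℂ] π.H) ∞ πV).continuous
  -- `W` need not respect adjoints, so the induction carries the statement for `star y` along with
  -- that for `y`. On generators the starred statement holds because the adjoint of a unitary is its
  -- inverse.
  have hadj : ∀ y ∈ StarAlgebra.adjoin ℂ (Set.range (universalElt : G → UniversalProduct G)),
      f y = f' y ∧ f (star y) = f' (star y) := by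
    intro y hy
    induction hy using StarAlgebra.adjoin_induction with
    | mem y hy =>
      obtain ⟨g, rfl⟩ := hy
      refine ⟨ContinuousLinearMap.ext fun ξ => hW g ξ, ContinuousLinearMap.ext fun ξ => ?_⟩
      change W (star (((U g : H ≃L[ℂ] H) : H →L[ℂ] H)) ξ) =
        star (((V g : K ≃L[ℂ] K) : K →L[ℂ] K)) (W ξ)
      rw [star_coe_isometryEquiv, star_coe_isometryEquiv]
      change W ((U g).symm ξ) = (V g).symm (W ξ)
      rw [LinearIsometryEquiv.eq_symm_apply, ← hW, LinearIsometryEquiv.apply_symm_apply]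
    | algebraMap c =>
      have h : ∀ c : ℂ, f (algebraMap ℂ _ c) = f' (algebraMap ℂ _ c) := fun c =>
        ContinuousLinearMap.ext fun ξ => map_smul W c ξ
      refine ⟨h c, ?_⟩
      rw [← algebraMap_star_comm]
      exact h _
    | add y z _ _ hy hz =>
      have h : ∀ y z, f y = f' y → f z = f' z → f (y + z) = f' (y + z) := fun y z hy hz =>
        ContinuousLinearMap.ext fun ξ => by
          change W ((y πU) ξ + (z πU) ξ) = (y πV) (W ξ) + (z πV) (W ξ)
          rw [map_add]
          exact congrArg₂ _ (DFunLike.congr_fun hy ξ) (DFunLike.congr_fun hz ξ)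
      exact ⟨h _ _ hy.1 hz.1, by rw [star_add]; exact h _ _ hy.2 hz.2⟩
    | mul y z _ _ hy hz =>
      have h : ∀ y z, f y = f' y → f z = f' z → f (y * z) = f' (y * z) := fun y z hy hz =>
        ContinuousLinearMap.ext fun ξ =>
          (DFunLike.congr_fun hy ((z πU) ξ)).trans
            (congrArg (y πV) (DFunLike.congr_fun hz ξ))
      exact ⟨h _ _ hy.1 hz.1, by rw [star_mul]; exact h _ _ hz.2 hy.2⟩
    | star y _ hy => exact ⟨hy.2, by rw [star_star]; exact hy.1⟩
  -- Both sides are norm continuous in the algebra element, so the identity passes to the closure.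
  have hclosed : IsClosed {y : UniversalProduct G | f y = f' y} := isClosed_eq hf hf'
  have hx : x.val ∈ {y : UniversalProduct G | f y = f' y} :=
    closure_minimal (fun y hy => (hadj y hy).1) hclosed
      (show x.val ∈ groupCStarSubalgebra G from (show groupCStarSubalgebra G from x).2)
  exact DFunLike.congr_fun hx ξ

theorem GroupCStar.unitarilyEquivalent_lift_iff {U : G →* (H ≃ₗᵢ[ℂ] H)}
    {V : G →* (K ≃ₗᵢ[ℂ] K)} :
    UnitarilyEquivalent (GroupCStar.lift U) (GroupCStar.lift V) ↔
      ∃ W : H ≃ₗᵢ[ℂ] K, ∀ g ξ, W (U g ξ) = V g (W ξ) :=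
  ⟨fun ⟨W, hW⟩ => ⟨W, fun g ξ => hW (GroupCStar.of g) ξ⟩,
    fun ⟨W, hW⟩ => ⟨W, GroupCStar.lift_intertwines ((W : H ≃L[ℂ] K) : H →L[ℂ] K) hW⟩⟩

/-- The *-centralizer also requires commutation with adjoints; this is automatic because the image
of the C*-algebra is closed under `star`. -/
theorem GroupCStar.mem_commutant_lift_iff {U : G →* (H ≃ₗᵢ[ℂ] H)} {T : H →L[ℂ] H} :
    T ∈ commutant (GroupCStar.lift U) ↔ ∀ g ξ, T (U g ξ) = U g (T ξ) := by
  constructor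
  · intro h g ξ
    exact (DFunLike.congr_fun
      ((StarSubalgebra.mem_centralizer_iff ℂ).1 h _ ⟨GroupCStar.of g, rfl⟩).1 ξ).symm
  · intro h
    refine (StarSubalgebra.mem_centralizer_iff ℂ).2 ?_
    rintro _ ⟨x, rfl⟩
    have h1 : ∀ x, GroupCStar.lift U x * T = T * GroupCStar.lift U x := fun x =>
      ContinuousLinearMap.ext fun ξ => (GroupCStar.lift_intertwines T h x ξ).symm
    refine ⟨h1 x, ?_⟩
    rw [← map_star]
    exact h1 _

end Intertwining

/-! ### Coordinates of the induced representations -/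

section Induced

variable {a : ℝˣ} {χ χ' : BDual a}

/-- The coordinate `φ(0, k)` of a vector of `H_χ^Ind`. -/
def IndSpace.coeff (φ : IndSpace χ) (k : ℤ) : ℂ := φ.val (GGrp.mk 1 k)

theorem IndSpace.ext_coeff {φ ψ : IndSpace χ} (h : ∀ k, φ.coeff k = ψ.coeff k) : φ = ψ :=
  (IndSpace.coordsEquiv χ).injective (lp.ext (funext h))

theorem IndSpace.coeff_smul (c : ℂ) (φ : IndSpace χ) (k : ℤ) :
    (c • φ).coeff k = c * φ.coeff k := rfl

theorem IndSpace.coeff_indBasis (j k : ℤ) :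
    (indBasis χ k).coeff j = if j = k then 1 else 0 := by
  rw [IndSpace.coeff, ← inner_indBasis]
  exact orthonormal_iff_ite.1 (indBasis χ).orthonormal j k

/-- The weighted shift formula: moving `(0, k)` past `b` produces `a^k b`, so the weight at `k` is
`χ ∘ α(k)`. -/
theorem IndSpace.coeff_indRep (g : GGrp a) (φ : IndSpace χ) (k : ℤ) :
    (indRep χ g φ).coeff k = χ (BGrp.smul k g.left) * φ.coeff (k + g.exp) := by
  change φ.val (GGrp.mk (1 * BGrp.smul k g.left) (k + g.exp)) = _
  rw [one_mul, IndSpace.val_mk]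
  rfl

theorem BGrp.smul_one (n : ℤ) : BGrp.smul n (1 : BGrp a) = 1 :=
  map_one (alpha a (Multiplicative.ofAdd n))

theorem indRep_mk_zero_basis (b : BGrp a) (k : ℤ) :
    indRep χ (GGrp.mk b 0) (indBasis χ k) = (χ (BGrp.smul k b) : ℂ) • indBasis χ k := by
  refine IndSpace.ext_coeff fun j => ?_
  rw [IndSpace.coeff_indRep, IndSpace.coeff_smul, IndSpace.coeff_indBasis, IndSpace.coeff_indBasis]
  change (χ (BGrp.smul j b) : ℂ) * (if j + 0 = k then 1 else 0) = _
  rw [add_zero]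
  split_ifs with h
  · rw [h]
  · simp

theorem indRep_mk_one_basis (k l : ℤ) :
    indRep χ (GGrp.mk 1 l) (indBasis χ k) = indBasis χ (k - l) := by
  refine IndSpace.ext_coeff fun j => ?_
  rw [IndSpace.coeff_indRep, IndSpace.coeff_indBasis, IndSpace.coeff_indBasis]
  change (χ (BGrp.smul j 1) : ℂ) * (if j + l = k then 1 else 0) = _
  rw [BGrp.smul_one, map_one, Circle.coe_one, one_mul]
  simp only [eq_sub_iff_add_eq]

theorem indRep_mk (b : BGrp a) (l : ℤ) :
    indRep χ (GGrp.mk b l) = indRep χ (GGrp.mk b 0) * indRep χ (GGrp.mk 1 l) := by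
  rw [← map_mul, GGrp.mk_mul]
  change _ = indRep χ (GGrp.mk (b * BGrp.smul 0 1) (0 + l))
  rw [BGrp.smul_zero, mul_one, zero_add]

theorem dualAut_zpow (n : ℤ) (χ : BDual a) : (dualAut a ^ n) χ = BDual.comp n χ := by
  have hadd : ∀ (m n : ℤ) (χ : BDual a), BDual.comp m (BDual.comp n χ) = BDual.comp (m + n) χ :=
    fun m n χ => PontryaginDual.ext fun b => by
      rw [BDual.comp_apply, BDual.comp_apply, BDual.comp_apply, BGrp.smul_smul, add_comm]
  induction n generalizing χ with
  | zero => exact PontryaginDual.ext fun b => by rw [BDual.comp_apply, BGrp.smul_zero]; rfl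
  | succ n ih =>
    rw [zpow_add_one, Equiv.Perm.mul_apply, ih]
    exact hadd _ _ _
  | pred n ih =>
    rw [zpow_sub_one, Equiv.Perm.mul_apply, ih]
    exact hadd _ _ _

theorem dualAut_pow (n : ℕ) (χ : BDual a) : (dualAut a ^ n) χ = BDual.comp n χ := by
  rw [← dualAut_zpow, zpow_natCast]

/-! ### Orbits of characters and unitary equivalence -/

/-- The shift by `n` on `ℓ²(ℤ)`. -/
def l2Shift (n : ℤ) : lp (fun _ : ℤ => ℂ) 2 ≃ₗᵢ[ℂ] lp (fun _ : ℤ => ℂ) 2 :=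
  rightRegular (Multiplicative ℤ) (Multiplicative.ofAdd n)

/-- Left translation by `(0, n)`, as a map from `H_χ^Ind` to `H_{χ ∘ α(n)}^Ind`. -/
def IndSpace.leftShift (χ : BDual a) (n : ℤ) : IndSpace χ ≃ₗᵢ[ℂ] IndSpace (BDual.comp n χ) :=
  ((IndSpace.coordsIsometry χ).trans (l2Shift n)).trans (IndSpace.coordsIsometry _).symm

theorem IndSpace.coeff_leftShift (n : ℤ) (φ : IndSpace χ) (k : ℤ) :
    (IndSpace.leftShift χ n φ).coeff k = φ.coeff (k + n) := by
  have h := LinearIsometryEquiv.apply_symm_apply (IndSpace.coordsIsometry (BDual.comp n χ))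
    (l2Shift n (IndSpace.coordsIsometry χ φ))
  exact congrArg (fun f : lp (fun _ : ℤ => ℂ) 2 => f k) h

/-- Left and right translations commute; in coordinates both sides have weight `χ(a^(k+n) b)`. -/
theorem IndSpace.leftShift_indRep (n : ℤ) (g : GGrp a) (φ : IndSpace χ) :
    IndSpace.leftShift χ n (indRep χ g φ) =
      indRep (BDual.comp n χ) g (IndSpace.leftShift χ n φ) := by
  refine IndSpace.ext_coeff fun k => ?_
  rw [IndSpace.coeff_leftShift, IndSpace.coeff_indRep, IndSpace.coeff_indRep,
    IndSpace.coeff_leftShift, BDual.comp_apply, BGrp.smul_smul, add_comm n k, add_right_comm]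

/-- Two induced representations are unitarily equivalent exactly when their characters lie in the
same orbit of the dual automorphism. -/
theorem unitarilyEquivalent_indCStarRep_iff :
    UnitarilyEquivalent (indCStarRep χ) (indCStarRep χ') ↔ (dualAut a).SameCycle χ χ' := by
  rw [indCStarRep, indCStarRep, GroupCStar.unitarilyEquivalent_lift_iff]
  constructor
  · rintro ⟨W, hW⟩
    -- The image of `e_0` is a nonzero joint eigenvector of `B_a` with character `χ`. At a nonzero
    -- coordinate `k` the target acts through `χ' ∘ α(k)`, so the two characters coincide.
    have hne : W (indBasis χ 0) ≠ 0 := fun h =>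
      (indBasis χ).orthonormal.ne_zero 0 ((map_eq_zero_iff W W.injective).1 h)
    obtain ⟨k, hk⟩ : ∃ k, (W (indBasis χ 0)).coeff k ≠ 0 := by
      by_contra! h
      exact hne (IndSpace.ext_coeff h)
    refine Equiv.Perm.SameCycle.symm ⟨k, ?_⟩
    rw [dualAut_zpow]
    refine PontryaginDual.ext fun b => ?_
    have h1 := hW (GGrp.mk b 0) (indBasis χ 0)
    rw [indRep_mk_zero_basis, map_smul, BGrp.smul_zero] at h1
    have h2 := congrArg (fun φ => IndSpace.coeff φ k) h1
    simp only [IndSpace.coeff_smul, IndSpace.coeff_indRep] at h2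
    change (χ b : ℂ) * _ = (χ' (BGrp.smul k b) : ℂ) * (W (indBasis χ 0)).coeff (k + 0) at h2
    rw [add_zero] at h2
    exact (Circle.coe_injective (mul_right_cancel₀ hk h2)).symm
  · rintro ⟨n, hn⟩
    rw [dualAut_zpow] at hn
    subst hn
    exact ⟨IndSpace.leftShift χ n, IndSpace.leftShift_indRep n⟩

theorem repClass_indCStarRep_eq_iff :
    repClass (indCStarRep χ) = repClass (indCStarRep χ') ↔ (dualAut a).SameCycle χ χ' :=
  Quotient.eq.trans unitarilyEquivalent_indCStarRep_iff

/-- An equivalence of sets that conjugates two permutations preserves and reflects orbits. -/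
theorem sameCycle_conj {α β : Type*} (e : α ≃ β) {f : Equiv.Perm α} {g : Equiv.Perm β}
    (h : ∀ x, e (f x) = g (e x)) {x y : α} : g.SameCycle (e x) (e y) ↔ f.SameCycle x y := by
  have hg : g = e.permCongr f := Equiv.ext fun y => by simp [h]
  have hpow : ∀ n : ℤ, (g ^ n) (e x) = e ((f ^ n) x) := fun n => by
    have h1 : g ^ n = e.permCongr (f ^ n) := by
      rw [hg]
      exact (map_zpow (Equiv.permCongrHom e) f n).symm
    rw [h1, Equiv.permCongr_apply, Equiv.symm_apply_apply]
  exact exists_congr fun n => by rw [hpow, e.apply_eq_iff_eq]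

/-- The bijection from the orbits of the shift in the solenoid to the classes of induced
representations. -/
theorem exists_orbits_equiv_inducedClasses (ψ : BDual a ≃ Solenoid (a : ℝ))
    (hψ : ∀ χ, ψ (dualAut a χ) = shift (a : ℝ) (ψ χ)) :
    ∃ e : SolenoidOrbits (a : ℝ) ≃ inducedClasses a,
      ∀ χ : BDual a, (e (Quotient.mk _ (ψ χ)) : RepClass (UAlg a)) = repClass (indCStarRep χ) := by
  -- One direction makes the map on orbits well defined, the other makes it injective.
  have hrel : ∀ y z, (shift (a : ℝ)).SameCycle y z ↔
      repClass (indCStarRep (ψ.symm y)) = repClass (indCStarRep (ψ.symm z)) := fun y z => by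
    rw [repClass_indCStarRep_eq_iff, ← sameCycle_conj ψ hψ, ψ.apply_symm_apply, ψ.apply_symm_apply]
  let f : SolenoidOrbits (a : ℝ) → inducedClasses a :=
    Quotient.lift (fun z => ⟨repClass (indCStarRep (ψ.symm z)), ψ.symm z, rfl⟩)
      fun y z h => Subtype.ext ((hrel y z).1 h)
  have hf : ∀ χ, (f (Quotient.mk _ (ψ χ)) : RepClass (UAlg a)) = repClass (indCStarRep χ) :=
    fun χ => by
      change repClass (indCStarRep (ψ.symm (ψ χ))) = _
      rw [ψ.symm_apply_apply]
  refine ⟨Equiv.ofBijective f ⟨?_, ?_⟩, hf⟩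
  · refine Quotient.ind₂ fun y z h => Quotient.sound ((hrel y z).2 (congrArg Subtype.val h))
  · rintro ⟨_, χ, rfl⟩
    exact ⟨Quotient.mk _ (ψ χ), Subtype.ext (hf χ)⟩

/-! ### Irreducibility for aperiodic characters -/

/-- Continuous linear maps that agree on a Hilbert basis are equal. -/
theorem HilbertBasis.continuousLinearMap_ext {ι H E : Type*} [NormedAddCommGroup H]
    [InnerProductSpace ℂ H] [NormedAddCommGroup E] [NormedSpace ℂ E] (b : HilbertBasis ι ℂ H)
    {S T : H →L[ℂ] E} (h : ∀ i, S (b i) = T (b i)) : S = T := by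
  refine ContinuousLinearMap.ext_on (s := Set.range b) ?_ ?_
  · rw [Submodule.dense_iff_topologicalClosure_eq_top]
    exact b.dense_span
  · rintro _ ⟨i, rfl⟩
    exact h i

/-- `T` preserves the joint eigenspaces of `B_a`, and `e_j`, `e_k` have different characters. -/
theorem coeff_eq_zero_of_commutes {T : IndSpace χ →L[ℂ] IndSpace χ}
    (hT : ∀ g φ, T (indRep χ g φ) = indRep χ g (T φ)) {j k : ℤ}
    (hjk : BDual.comp j χ ≠ BDual.comp k χ) : (T (indBasis χ k)).coeff j = 0 := by
  by_contra h0
  refine hjk (PontryaginDual.ext fun b => ?_)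
  have h1 := congrArg (fun φ => IndSpace.coeff φ j) (hT (GGrp.mk b 0) (indBasis χ k))
  simp only [indRep_mk_zero_basis, map_smul, IndSpace.coeff_smul, IndSpace.coeff_indRep] at h1
  change (χ (BGrp.smul k b) : ℂ) * _ =
    (χ (BGrp.smul j b) : ℂ) * (T (indBasis χ k)).coeff (j + 0) at h1
  rw [add_zero] at h1
  exact (Circle.coe_injective (mul_right_cancel₀ h0 h1)).symm

/-- A coincidence at `m < n` would return `χ` to itself after `n - m` steps. -/
theorem IsAperiodicPt.comp_injective (hχ : IsAperiodicPt a χ) :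
    Function.Injective fun n : ℤ => BDual.comp n χ := by
  have key : ∀ m n : ℤ, m < n → BDual.comp m χ ≠ BDual.comp n χ := fun m n hmn h => by
    refine hχ (n - m).toNat (by omega) ?_
    rw [← zpow_natCast, Int.toNat_of_nonneg (by omega), sub_eq_neg_add, zpow_add,
      Equiv.Perm.mul_apply, dualAut_zpow n, ← h, ← dualAut_zpow m, ← Equiv.Perm.mul_apply,
      ← zpow_add, neg_add_cancel, zpow_zero, Equiv.Perm.one_apply]
  intro m n h
  rcases lt_trichotomy m n with h1 | h1 | h1
  · exact (key m n h1 h).elim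
  · exact h1
  · exact (key n m h1 h.symm).elim

/-- For an aperiodic character, the commutant of the induced representation is trivial. -/
theorem IsAperiodicPt.exists_eq_smul (hχ : IsAperiodicPt a χ) {T : IndSpace χ →L[ℂ] IndSpace χ}
    (hT : ∀ g φ, T (indRep χ g φ) = indRep χ g (T φ)) : ∃ c : ℂ, ∀ φ, T φ = c • φ := by
  refine ⟨(T (indBasis χ 0)).coeff 0, fun φ => ?_⟩
  have h0 : T (indBasis χ 0) = (T (indBasis χ 0)).coeff 0 • indBasis χ 0 := by
    refine IndSpace.ext_coeff fun j => ?_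
    rw [IndSpace.coeff_smul, IndSpace.coeff_indBasis]
    split_ifs with h
    · rw [h, mul_one]
    · rw [coeff_eq_zero_of_commutes hT (fun h' => h (hχ.comp_injective h')), mul_zero]
  have h1 : T = (T (indBasis χ 0)).coeff 0 • ContinuousLinearMap.id ℂ (IndSpace χ) := by
    refine (indBasis χ).continuousLinearMap_ext fun k => ?_
    -- Translations carry `e_0` to every `e_k`, so all diagonal entries equal the one at `0`.
    have h2 : indBasis χ k = indRep χ (GGrp.mk 1 (-k)) (indBasis χ 0) := by
      rw [indRep_mk_one_basis, zero_sub, neg_neg]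
    conv_lhs => rw [h2, hT, h0, map_smul, ← h2]
    rfl
  exact DFunLike.congr_fun h1 φ

/-- The orthogonal projection onto a closed invariant subspace commutes with the group, hence is a
scalar; a nonzero vector of the subspace forces the scalar to be `1`. -/
theorem IsAperiodicPt.isIrreducibleRep (hχ : IsAperiodicPt a χ) :
    IsIrreducibleRep (indCStarRep χ) := by
  refine ⟨inferInstance, fun K hK hinv => ?_⟩
  have : CompleteSpace K := hK.completeSpace_coe
  have hinv' : ∀ g, ∀ φ ∈ K, indRep χ g φ ∈ K := fun g φ hφ => hinv (GroupCStar.of g) φ hφ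
  have hperp : ∀ g, ∀ φ ∈ Kᗮ, indRep χ g φ ∈ Kᗮ := fun g φ hφ => by
    refine (Submodule.mem_orthogonal _ _).2 fun ψ hψ => ?_
    have h1 : ψ = indRep χ g (indRep χ g⁻¹ ψ) := by
      change ψ = (indRep χ g * indRep χ g⁻¹) ψ
      rw [← map_mul, mul_inv_cancel, map_one]
      rfl
    rw [h1, LinearIsometryEquiv.inner_map_map]
    exact (Submodule.mem_orthogonal _ _).1 hφ _ (hinv' _ _ hψ)
  obtain ⟨c, hc⟩ := hχ.exists_eq_smul (T := K.starProjection) fun g φ => by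
    refine Submodule.eq_starProjection_of_mem_orthogonal
      (hinv' g _ (K.starProjection_apply_mem φ)) ?_
    rw [← map_sub]
    exact hperp g _ (K.sub_starProjection_mem_orthogonal φ)
  by_cases hbot : K = ⊥
  · exact Or.inl hbot
  · refine Or.inr (eq_top_iff.2 fun φ _ => ?_)
    obtain ⟨ψ, hψ, hψ0⟩ := Submodule.exists_mem_ne_zero_of_ne_bot hbot
    have h1 : c • ψ = (1 : ℂ) • ψ := by
      rw [← hc, one_smul, Submodule.starProjection_eq_self_iff.2 hψ]
    have h2 : c = 1 := smul_left_injective ℂ hψ0 h1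
    rw [← Submodule.starProjection_eq_self_iff, hc, h2, one_smul]

theorem IsPeriodicPt.exists_of_not_isAperiodicPt (hχ : ¬ IsAperiodicPt a χ) :
    ∃ q, IsPeriodicPt a q χ := by
  classical
  unfold IsAperiodicPt at hχ
  push Not at hχ
  refine ⟨Nat.find hχ, (Nat.find_spec hχ).1, (Nat.find_spec hχ).2, fun k hk hkq h => ?_⟩
  exact Nat.find_min hχ hkq ⟨hk, h⟩

end Induced

/-! ### Multiplication operators -/

section MulOp

variable {X : Type*} [MeasurableSpace X] {μ : Measure X}

/-- Multiplication by a bounded function on `L²`. -/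
def mulOp (f : Lp ℂ ∞ μ) : Lp ℂ 2 μ →L[ℂ] Lp ℂ 2 μ :=
  (ContinuousLinearMap.mul ℂ ℂ).holderL μ ∞ 2 2 f

theorem coeFn_mulOp (f : Lp ℂ ∞ μ) (h : Lp ℂ 2 μ) : mulOp f h =ᵐ[μ] fun x => f x * h x :=
  (ContinuousLinearMap.mul ℂ ℂ).coeFn_holder f h

theorem mulOp_add (f g : Lp ℂ ∞ μ) : mulOp (f + g) = mulOp f + mulOp g := map_add _ f g

theorem mulOp_smul (c : ℂ) (f : Lp ℂ ∞ μ) : mulOp (c • f) = c • mulOp f := map_smul _ c f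

theorem norm_mulOp_apply_le (f : Lp ℂ ∞ μ) (h : Lp ℂ 2 μ) : ‖mulOp f h‖ ≤ ‖f‖ * ‖h‖ := by
  refine ((ContinuousLinearMap.mul ℂ ℂ).norm_holder_apply_apply_le f h).trans ?_
  gcongr
  exact mul_le_of_le_one_left (norm_nonneg _) (ContinuousLinearMap.opNorm_mul_le ℂ ℂ)

theorem mulOp_comm (f g : Lp ℂ ∞ μ) (h : Lp ℂ 2 μ) :
    mulOp f (mulOp g h) = mulOp g (mulOp f h) := by
  refine Lp.ext ?_
  filter_upwards [coeFn_mulOp f (mulOp g h), coeFn_mulOp g h, coeFn_mulOp g (mulOp f h),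
    coeFn_mulOp f h] with x h1 h2 h3 h4
  rw [h1, h2, h3, h4, mul_left_comm]

theorem mulOp_of_ae_mul {f g k : Lp ℂ ∞ μ} (hk : k =ᵐ[μ] fun x => f x * g x) :
    mulOp k = mulOp f * mulOp g := by
  refine ContinuousLinearMap.ext fun h => Lp.ext ?_
  filter_upwards [coeFn_mulOp k h, coeFn_mulOp f (mulOp g h), coeFn_mulOp g h, hk]
    with x h1 h2 h3 h4
  change _ = mulOp f (mulOp g h) x
  rw [h1, h2, h3, h4, mul_assoc]

theorem mulOp_of_ae_star {f g : Lp ℂ ∞ μ} (hg : g =ᵐ[μ] fun x => star (f x)) :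
    mulOp g = ContinuousLinearMap.adjoint (mulOp f) := by
  refine (ContinuousLinearMap.eq_adjoint_iff _ _).2 fun h k => ?_
  rw [L2.inner_def, L2.inner_def]
  refine integral_congr_ae ?_
  filter_upwards [coeFn_mulOp g h, coeFn_mulOp f k, hg] with x h1 h2 h3
  rw [h1, h2, h3]
  simp only [RCLike.inner_apply, map_mul, RCLike.star_def, RingHomCompTriple.comp_apply,
    RingHom.id_apply]
  ring

/-- If a bounded operator on `L²` is multiplication by a function, the function is essentially
bounded by every bound of the operator. -/
theorem ae_norm_le_of_mul_bound [IsFiniteMeasure μ] {A : Lp ℂ 2 μ → Lp ℂ 2 μ} {u : Lp ℂ 2 μ}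
    (hA : ∀ h, A h =ᵐ[μ] fun x => u x * h x) {C : ℝ} (hC : ∀ h, ‖A h‖ ≤ C * ‖h‖) :
    ∀ᵐ x ∂μ, ‖u x‖ ≤ C := by
  have key : ∀ ε : ℝ, 0 < ε → ∀ᵐ x ∂μ, ‖u x‖ < C + ε := fun ε hε => by
    -- Test the operator on the indicator of the set where the bound fails by `ε`: the operator
    -- expands it by at least `C + ε`, so the indicator has norm zero.
    let E : Set X := {x | C + ε ≤ ‖u x‖}
    have hE : MeasurableSet E :=
      measurableSet_le measurable_const (Lp.stronglyMeasurable u).norm.measurable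
    let h : Lp ℂ 2 μ := indicatorConstLp 2 hE (measure_ne_top μ E) (1 : ℂ)
    have h1 : (C + ε) * ‖h‖ ≤ ‖A h‖ := by
      -- `C` is not assumed nonnegative, and the estimate divides by `C + ε`.
      rcases le_or_gt (C + ε) 0 with hCε | hCε
      · exact (mul_nonpos_of_nonpos_of_nonneg hCε (norm_nonneg _)).trans (norm_nonneg _)
      have h2 : ‖h‖ ≤ (C + ε)⁻¹ * ‖A h‖ := by
        refine Lp.norm_le_mul_norm_of_ae_le_mul ?_
        filter_upwards [hA h, indicatorConstLp_coeFn (p := 2) (hs := hE)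
          (hμs := measure_ne_top μ E) (c := (1 : ℂ))] with x hx hx'
        rw [hx, norm_mul]
        change ‖h x‖ ≤ _
        have hx'' : h x = E.indicator (fun _ => (1 : ℂ)) x := hx'
        rw [hx'']
        by_cases hxE : x ∈ E
        · rw [Set.indicator_of_mem hxE, norm_one, mul_one, inv_mul_eq_div, one_le_div hCε]
          exact hxE
        · rw [Set.indicator_of_notMem hxE, norm_zero, mul_zero, mul_zero]
      rwa [inv_mul_eq_div, le_div_iff₀ hCε, mul_comm] at h2
    have h3 : ‖h‖ = 0 := by
      have := h1.trans (hC h)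
      have := norm_nonneg h
      nlinarith
    rw [norm_indicatorConstLp (by norm_num) (by norm_num), norm_one, one_mul,
      Real.rpow_eq_zero measureReal_nonneg (by norm_num), measureReal_eq_zero_iff] at h3
    filter_upwards [compl_mem_ae_iff.2 h3] with x hx
    exact not_le.1 hx
  have h1 : ∀ᵐ x ∂μ, ∀ n : ℕ, ‖u x‖ < C + 1 / ((n : ℝ) + 1) :=
    ae_all_iff.2 fun n => key _ (by positivity)
  filter_upwards [h1] with x hx
  refine le_of_forall_pos_le_add fun ε hε => ?_
  obtain ⟨n, hn⟩ := exists_nat_one_div_lt hε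
  exact (hx n).le.trans (by linarith)

/-- The set of `h ∈ L²` with `A h = u · V h` is a closed subspace. -/
theorem ae_eq_mul_of_mem_closure_span (A V : Lp ℂ 2 μ →L[ℂ] Lp ℂ 2 μ) (u : X → ℂ)
    {s : Set (Lp ℂ 2 μ)} (hs : ∀ h ∈ s, A h =ᵐ[μ] fun x => u x * V h x) {h : Lp ℂ 2 μ}
    (hh : h ∈ (Submodule.span ℂ s).topologicalClosure) : A h =ᵐ[μ] fun x => u x * V h x := by
  let P : Submodule ℂ (Lp ℂ 2 μ) :=
    { carrier := {h | A h =ᵐ[μ] fun x => u x * V h x}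
      zero_mem' := by
        change A 0 =ᵐ[μ] fun x => u x * V 0 x
        rw [map_zero, map_zero]
        filter_upwards [Lp.coeFn_zero ℂ 2 μ] with x hx
        rw [hx, Pi.zero_apply, mul_zero]
      add_mem' := by
        intro f g hf hg
        change A (f + g) =ᵐ[μ] fun x => u x * V (f + g) x
        rw [map_add, map_add]
        filter_upwards [hf, hg, Lp.coeFn_add (A f) (A g), Lp.coeFn_add (V f) (V g)]
          with x h1 h2 h3 h4
        rw [h3, h4, Pi.add_apply, Pi.add_apply, h1, h2, mul_add]
      smul_mem' := by
        intro c f hf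
        change A (c • f) =ᵐ[μ] fun x => u x * V (c • f) x
        rw [map_smul, map_smul]
        filter_upwards [hf, Lp.coeFn_smul c (A f), Lp.coeFn_smul c (V f)] with x h1 h2 h3
        rw [h2, h3, Pi.smul_apply, Pi.smul_apply, h1, smul_eq_mul, smul_eq_mul, mul_left_comm] }
  have hP : IsClosed (P : Set (Lp ℂ 2 μ)) := by
    -- An `L²`-convergent sequence converges almost everywhere along a subsequence. The second
    -- subsequence is taken inside the first, so that both images converge along it.
    refine IsSeqClosed.isClosed fun f g hf hg => ?_
    obtain ⟨n₁, hn₁, h1⟩ := (tendstoInMeasure_of_tendsto_Lp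
      ((A.continuous.tendsto g).comp hg)).exists_seq_tendsto_ae
    obtain ⟨n₂, hn₂, h2⟩ := (tendstoInMeasure_of_tendsto_Lp
      ((V.continuous.tendsto g).comp (hg.comp hn₁.tendsto_atTop))).exists_seq_tendsto_ae
    have h3 : ∀ᵐ x ∂μ, ∀ n, A (f n) x = u x * V (f n) x := ae_all_iff.2 hf
    change A g =ᵐ[μ] fun x => u x * V g x
    filter_upwards [h1, h2, h3] with x hx1 hx2 hx3
    refine tendsto_nhds_unique (hx1.comp hn₂.tendsto_atTop) ?_
    refine (hx2.const_mul (u x)).congr fun n => ?_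
    exact (hx3 _).symm
  have hsP : s ⊆ P := fun h hh => hs h hh
  exact Submodule.topologicalClosure_minimal _ (Submodule.span_le.2 hsP) hP hh

end MulOp

/-! ### Operators on `L²` of the circle -/

section CircleOps

/-- `L²(𝕋)` for the circle `𝕋 = ℝ/ℤ`. -/
abbrev L2Circle : Type := Lp ℂ 2 (AddCircle.haarAddCircle (T := (1 : ℝ)))

/-- The character `t ↦ e^{2 π i n t}` as an element of `L^∞(𝕋)`. -/
def fourierInfty (n : ℤ) : LInftyCircle := contToLInfty (fourier n)

theorem coeFn_fourierInfty (n : ℤ) :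
    fourierInfty n =ᵐ[AddCircle.haarAddCircle] (fourier n : AddCircle (1 : ℝ) → ℂ) :=
  ContinuousMap.coeFn_toLp _ _

theorem mulOp_fourierInfty (m n : ℤ) :
    mulOp (fourierInfty m) (fourierLp 2 n) = fourierLp 2 (m + n) := by
  refine Lp.ext ?_
  filter_upwards [coeFn_mulOp (fourierInfty m) (fourierLp 2 n), coeFn_fourierInfty m,
    coeFn_fourierLp (T := (1 : ℝ)) 2 n, coeFn_fourierLp (T := (1 : ℝ)) 2 (m + n)]
    with x h1 h2 h3 h4
  rw [h1, h2, h3, h4, fourier_add]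

theorem mem_closure_span_fourierLp (h : L2Circle) :
    h ∈ (Submodule.span ℂ (Set.range (fourierLp (T := (1 : ℝ)) 2))).topologicalClosure := by
  rw [span_fourierLp_closure_eq_top (by norm_num)]
  trivial

theorem continuousLinearMap_ext_fourierLp {E : Type*} [NormedAddCommGroup E] [NormedSpace ℂ E]
    {S T : L2Circle →L[ℂ] E} (h : ∀ k, S (fourierLp 2 k) = T (fourierLp 2 k)) : S = T := by
  refine fourierBasis.continuousLinearMap_ext fun k => ?_
  rw [coe_fourierBasis]
  exact h k

/-- An operator on `L²(𝕋)` that commutes with multiplication by characters is multiplication by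
the image of the constant function `1`. -/
theorem coeFn_of_commutes_fourier {A : L2Circle →L[ℂ] L2Circle}
    (hA : ∀ n, A (fourierLp 2 n) = mulOp (fourierInfty n) (A (fourierLp 2 0))) (h : L2Circle) :
    A h =ᵐ[AddCircle.haarAddCircle] fun x => A (fourierLp 2 0) x * h x := by
  refine ae_eq_mul_of_mem_closure_span A (ContinuousLinearMap.id ℂ _) _ ?_
    (mem_closure_span_fourierLp h)
  rintro _ ⟨n, rfl⟩
  rw [hA n, ContinuousLinearMap.id_apply]
  filter_upwards [coeFn_mulOp (fourierInfty n) (A (fourierLp 2 0)), coeFn_fourierInfty n,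
    coeFn_fourierLp (T := (1 : ℝ)) 2 n] with x h1 h2 h3
  rw [h1, h2, h3, mul_comm]

/-- The circle has finite measure, so `f` lies in `L²` and the bound for general multipliers
applies; testing on the constant `1` shows `C ≥ 0`. -/
theorem norm_le_of_mulOp_bound {f : LInftyCircle} {C : ℝ}
    (hC : ∀ h : L2Circle, ‖mulOp f h‖ ≤ C * ‖h‖) : ‖f‖ ≤ C := by
  have hf2 : MemLp f 2 (AddCircle.haarAddCircle (T := (1 : ℝ))) :=
    (Lp.memLp f).mono_exponent le_top
  have h1 := ae_norm_le_of_mul_bound (A := mulOp f) (u := hf2.toLp f) (fun h => by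
    filter_upwards [coeFn_mulOp f h, hf2.coeFn_toLp] with x h1 h2
    rw [h1, h2]) hC
  have hC0 : 0 ≤ C := by
    have h2 := (norm_nonneg _).trans (hC (fourierLp 2 0))
    rwa [orthonormal_fourier.1 0, mul_one] at h2
  have h2 : ∀ᵐ x ∂(AddCircle.haarAddCircle (T := (1 : ℝ))), ‖f x‖ ≤ C := by
    filter_upwards [h1, hf2.coeFn_toLp] with x h1 h2
    rwa [h2] at h1
  have h3 := Lp.norm_le_of_ae_bound hC0 h2
  simpa using h3

/-! ### The substitution `t ↦ q t` -/

/-- A continuous surjective endomorphism of a compact group preserves normalized Haar measure;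
surjectivity is divisibility of the circle. -/
theorem measurePreserving_nsmul_circle {q : ℕ} (hq : 0 < q) :
    MeasurePreserving (fun t : AddCircle (1 : ℝ) => q • t) AddCircle.haarAddCircle
      AddCircle.haarAddCircle := by
  refine AddMonoidHom.measurePreserving (f := nsmulAddMonoidHom (α := AddCircle (1 : ℝ)) q)
    (continuous_nsmul q) (fun t => ?_) rfl
  refine ⟨DivisibleBy.div t (q : ℤ), ?_⟩
  have h := DivisibleBy.div_cancel t (n := (q : ℤ)) (by exact_mod_cast hq.ne')
  rwa [natCast_zsmul] at h

/-- The isometry `f ↦ f(q ·)` of `L^p(𝕋)`. -/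
def substL {q : ℕ} (hq : 0 < q) (p : ℝ≥0∞) [Fact (1 ≤ p)] :
    Lp ℂ p (AddCircle.haarAddCircle (T := (1 : ℝ))) →ₗᵢ[ℂ]
      Lp ℂ p (AddCircle.haarAddCircle (T := (1 : ℝ))) :=
  Lp.compMeasurePreservingₗᵢ ℂ _ (measurePreserving_nsmul_circle hq)

theorem coeFn_substL {q : ℕ} (hq : 0 < q) (p : ℝ≥0∞) [Fact (1 ≤ p)]
    (f : Lp ℂ p (AddCircle.haarAddCircle (T := (1 : ℝ)))) :
    substL hq p f =ᵐ[AddCircle.haarAddCircle] fun t => f (q • t) :=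
  Lp.coeFn_compMeasurePreserving f (measurePreserving_nsmul_circle hq)

theorem ae_comp_nsmul {q : ℕ} (hq : 0 < q) {P : AddCircle (1 : ℝ) → Prop}
    (h : ∀ᵐ t ∂AddCircle.haarAddCircle, P t) : ∀ᵐ t ∂AddCircle.haarAddCircle, P (q • t) :=
  (measurePreserving_nsmul_circle hq).quasiMeasurePreserving.ae h

theorem ae_of_ae_comp_nsmul {q : ℕ} (hq : 0 < q) {P : AddCircle (1 : ℝ) → Prop}
    (hP : MeasurableSet {t | P t}) (h : ∀ᵐ t ∂AddCircle.haarAddCircle, P (q • t)) :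
    ∀ᵐ t ∂AddCircle.haarAddCircle, P t := by
  have hmp := measurePreserving_nsmul_circle hq
  have h1 := (ae_map_iff hmp.measurable.aemeasurable hP).2 h
  rwa [hmp.map_eq] at h1

/-- There are nonzero bounded functions on the circle with product zero. -/
theorem exists_mul_eq_zero_LInftyCircle : ∃ f g : LInftyCircle, ((0 : LInftyCircle)
    =ᵐ[AddCircle.haarAddCircle] fun t => f t * g t) ∧ f ≠ 0 ∧ g ≠ 0 := by
  -- Bumps around `0` and around `1/2`, with disjoint supports up to the points of norm `1/4`.
  let f : C(AddCircle (1 : ℝ), ℂ) := ⟨fun t => ((max 0 (1 / 4 - ‖t‖) : ℝ) : ℂ), by fun_prop⟩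
  let g : C(AddCircle (1 : ℝ), ℂ) := ⟨fun t => ((max 0 (‖t‖ - 1 / 4) : ℝ) : ℂ), by fun_prop⟩
  have hinj : ∀ (f : C(AddCircle (1 : ℝ), ℂ)) (t), f t ≠ 0 → contToLInfty f ≠ 0 :=
    fun f t ht h => ht (DFunLike.congr_fun (ContinuousMap.toLp_injective (𝕜 := ℂ) (p := ∞)
      (AddCircle.haarAddCircle (T := (1 : ℝ))) (h.trans (map_zero _).symm)) t)
  refine ⟨contToLInfty f, contToLInfty g, ?_, hinj f 0 ?_,
    hinj g ((1 / 2 : ℝ) : AddCircle (1 : ℝ)) ?_⟩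
  · filter_upwards [Lp.coeFn_zero ℂ ∞ (AddCircle.haarAddCircle (T := (1 : ℝ))),
      ContinuousMap.coeFn_toLp (p := ∞) (𝕜 := ℂ) AddCircle.haarAddCircle f,
      ContinuousMap.coeFn_toLp (p := ∞) (𝕜 := ℂ) AddCircle.haarAddCircle g] with t h1 h2 h3
    rw [h1, Pi.zero_apply, contToLInfty, contToLInfty, h2, h3]
    change (0 : ℂ) = ((max 0 (1 / 4 - ‖t‖) : ℝ) : ℂ) * ((max 0 (‖t‖ - 1 / 4) : ℝ) : ℂ)
    rcases le_total ‖t‖ (1 / 4) with h | h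
    · rw [max_eq_left (sub_nonpos.2 h), Complex.ofReal_zero, mul_zero]
    · rw [max_eq_left (sub_nonpos.2 h), Complex.ofReal_zero, zero_mul]
  · change ((max 0 (1 / 4 - ‖(0 : AddCircle (1 : ℝ))‖) : ℝ) : ℂ) ≠ 0
    rw [norm_zero]
    norm_num
  · change ((max 0 (‖((1 / 2 : ℝ) : AddCircle (1 : ℝ))‖ - 1 / 4) : ℝ) : ℂ) ≠ 0
    rw [AddCircle.norm_half_period_eq]
    norm_num

theorem substL_fourierLp {q : ℕ} (hq : 0 < q) (n : ℤ) :
    substL hq 2 (fourierLp 2 n) = fourierLp 2 (q * n) := by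
  refine Lp.ext ?_
  filter_upwards [coeFn_substL hq 2 (fourierLp 2 n),
    ae_comp_nsmul hq (coeFn_fourierLp (T := (1 : ℝ)) 2 n),
    coeFn_fourierLp (T := (1 : ℝ)) 2 (q * n)] with t h1 h2 h3
  rw [h1, h2, h3, fourier_apply, fourier_apply, ← natCast_zsmul, smul_smul, mul_comm]

/-- A function whose Fourier coefficients are supported on the multiples of `q` is of the form
`f(q ·)`. -/
theorem exists_substL_eq {q : ℕ} (hq : 0 < q) {g : L2Circle}
    (hg : ∀ j : ℤ, ¬ (q : ℤ) ∣ j → inner ℂ (fourierLp 2 j) g = 0) : ∃ f, substL hq 2 f = g := by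
  -- The range of an isometry of a complete space is closed, and every partial Fourier sum of `g`
  -- lies in it.
  have hclosed : IsClosed ((substL hq 2).toLinearMap.range : Set L2Circle) :=
    (substL hq 2).isometry.isClosedEmbedding.isClosed_range
  have h1 : g ∈ (substL hq 2).toLinearMap.range := by
    refine hclosed.mem_of_tendsto (fourierBasis.hasSum_repr g) (Filter.Eventually.of_forall
      fun s => Submodule.sum_mem _ fun j _ => ?_)
    rw [fourierBasis.repr_apply_apply, coe_fourierBasis]
    by_cases hj : (q : ℤ) ∣ j
    · obtain ⟨n, rfl⟩ := hj
      exact Submodule.smul_mem _ _ ⟨fourierLp 2 n, substL_fourierLp hq n⟩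
    · rw [hg j hj, zero_smul]
      exact Submodule.zero_mem _
  exact h1

end CircleOps

/-! ### The commutant of the induced representation of a periodic character -/

section Periodic

variable {a : ℝˣ} {χ : BDual a} {q : ℕ}

theorem BDual.comp_zero (χ : BDual a) : BDual.comp 0 χ = χ := by
  rw [← dualAut_zpow, zpow_zero, Equiv.Perm.one_apply]

theorem IsPeriodicPt.comp_mul (hχ : IsPeriodicPt a q χ) (n : ℤ) :
    BDual.comp (q * n) χ = χ := by
  rw [← dualAut_zpow, zpow_mul, zpow_natCast]
  exact Equiv.Perm.zpow_apply_eq_self_of_apply_eq_self hχ.2.1 n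

theorem IsPeriodicPt.comp_add_mul (hχ : IsPeriodicPt a q χ) (k n : ℤ) :
    BDual.comp (k + q * n) χ = BDual.comp k χ := by
  rw [← dualAut_zpow, zpow_add, Equiv.Perm.mul_apply, dualAut_zpow (q * n), hχ.comp_mul,
    dualAut_zpow]

/-- A nonzero remainder of `j` modulo `q` would be a shorter period. -/
theorem IsPeriodicPt.dvd_of_comp_eq (hχ : IsPeriodicPt a q χ) {j : ℤ}
    (hj : BDual.comp j χ = BDual.comp 0 χ) : (q : ℤ) ∣ j := by
  have hq : (0 : ℤ) < q := by exact_mod_cast hχ.1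
  by_contra h
  have h1 : 0 ≤ j % q := Int.emod_nonneg j hq.ne'
  have h2 : j % q < q := Int.emod_lt_of_pos j hq
  have h3 : j % q ≠ 0 := fun h' => h (Int.dvd_of_emod_eq_zero h')
  refine hχ.2.2 (j % q).toNat (by omega) (by omega) ?_
  rw [dualAut_pow, Int.toNat_of_nonneg h1, ← hχ.comp_add_mul (j % q) (j / q), Int.emod_add_mul_ediv,
    hj, BDual.comp_zero]

/-- The Fourier transform from `H_χ^Ind` to `L²(𝕋)`, with `e_k ↦ e^{2 π i k t}`. -/
def IndSpace.fourier (χ : BDual a) : IndSpace χ ≃ₗᵢ[ℂ] L2Circle :=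
  (indBasis χ).repr.trans fourierBasis.repr.symm

theorem IndSpace.fourier_basis (k : ℤ) :
    IndSpace.fourier χ (indBasis χ k) = fourierLp 2 k := by
  classical
  rw [IndSpace.fourier, LinearIsometryEquiv.trans_apply, HilbertBasis.repr_self,
    HilbertBasis.repr_symm_single, coe_fourierBasis]

theorem IndSpace.fourier_symm_fourierLp (k : ℤ) :
    (IndSpace.fourier χ).symm (fourierLp 2 k) = indBasis χ k := by
  rw [LinearIsometryEquiv.symm_apply_eq, IndSpace.fourier_basis]

theorem IndSpace.fourier_translate (l : ℤ) (φ : IndSpace χ) :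
    IndSpace.fourier χ (indRep χ (GGrp.mk 1 l) φ) =
      mulOp (fourierInfty (-l)) (IndSpace.fourier χ φ) := by
  let F : IndSpace χ →L[ℂ] L2Circle := ((IndSpace.fourier χ : IndSpace χ ≃L[ℂ] L2Circle) : _)
  let U : IndSpace χ →L[ℂ] IndSpace χ :=
    ((indRep χ (GGrp.mk 1 l) : IndSpace χ ≃L[ℂ] IndSpace χ) : _)
  have h : F ∘L U = mulOp (fourierInfty (-l)) ∘L F :=
      (indBasis χ).continuousLinearMap_ext fun k => by
    change IndSpace.fourier χ (indRep χ (GGrp.mk 1 l) (indBasis χ k)) =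
      mulOp (fourierInfty (-l)) (IndSpace.fourier χ (indBasis χ k))
    rw [indRep_mk_one_basis, IndSpace.fourier_basis, IndSpace.fourier_basis, mulOp_fourierInfty,
      sub_eq_neg_add]
  exact DFunLike.congr_fun h φ

/-- A bounded function on the circle as an element of `L²`. -/
def LInftyCircle.toL2 (f : LInftyCircle) : L2Circle :=
  ((Lp.memLp f).mono_exponent (p := 2) le_top).toLp f

theorem LInftyCircle.coeFn_toL2 (f : LInftyCircle) :
    LInftyCircle.toL2 f =ᵐ[AddCircle.haarAddCircle] f := MemLp.coeFn_toLp _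

/-- On a basis vector the multiplication depends on `f` only through its `L²` class. This allows
approximation by trigonometric polynomials, which are dense in `L²` but not in `L^∞`. -/
theorem mulOp_substL_fourierLp (hq : 0 < q) (f : LInftyCircle) (k : ℤ) :
    mulOp (substL hq ∞ f) (fourierLp 2 k) =
      mulOp (fourierInfty k) (substL hq 2 (LInftyCircle.toL2 f)) := by
  refine Lp.ext ?_
  filter_upwards [coeFn_mulOp (substL hq ∞ f) (fourierLp 2 k),
    coeFn_mulOp (fourierInfty k) (substL hq 2 (LInftyCircle.toL2 f)), coeFn_substL hq ∞ f,
    coeFn_substL hq 2 (LInftyCircle.toL2 f), ae_comp_nsmul hq (LInftyCircle.coeFn_toL2 f),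
    coeFn_fourierInfty k, coeFn_fourierLp (T := (1 : ℝ)) 2 k] with t h1 h2 h3 h4 h5 h6 h7
  rw [h1, h2, h3, h4, h5, h6, h7, mul_comm]

/-- The operator on `H_χ^Ind` that corresponds to multiplication by `f(q ·)` on `L²(𝕋)`. -/
def periodicOp (χ : BDual a) (hq : 0 < q) (f : LInftyCircle) : IndSpace χ →L[ℂ] IndSpace χ :=
  (((IndSpace.fourier χ).symm : L2Circle ≃L[ℂ] IndSpace χ) : L2Circle →L[ℂ] IndSpace χ) ∘L
    mulOp (substL hq ∞ f) ∘L
      ((IndSpace.fourier χ : IndSpace χ ≃L[ℂ] L2Circle) : IndSpace χ →L[ℂ] L2Circle)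

theorem fourier_periodicOp (hq : 0 < q) (f : LInftyCircle) (φ : IndSpace χ) :
    IndSpace.fourier χ (periodicOp χ hq f φ) =
      mulOp (substL hq ∞ f) (IndSpace.fourier χ φ) :=
  LinearIsometryEquiv.apply_symm_apply _ _

theorem periodicOp_translate (hq : 0 < q) (f : LInftyCircle) (l : ℤ) (φ : IndSpace χ) :
    periodicOp χ hq f (indRep χ (GGrp.mk 1 l) φ) =
      indRep χ (GGrp.mk 1 l) (periodicOp χ hq f φ) := by
  refine (IndSpace.fourier χ).injective ?_
  rw [fourier_periodicOp, IndSpace.fourier_translate, IndSpace.fourier_translate,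
    fourier_periodicOp, mulOp_comm]

/-- The frequencies of `e^(2πikt) f(qt)` lie in `k + qℤ`, and `B_a` acts on all the corresponding
`e_(k+qn)` by the single character `χ ∘ α(k)`. -/
theorem IsPeriodicPt.indRep_fourier_symm (hχ : IsPeriodicPt a q χ) (b : BGrp a) (k : ℤ)
    (f : L2Circle) :
    indRep χ (GGrp.mk b 0) ((IndSpace.fourier χ).symm
        (mulOp (fourierInfty k) (substL hχ.1 2 f))) =
      (χ (BGrp.smul k b) : ℂ) • (IndSpace.fourier χ).symm
        (mulOp (fourierInfty k) (substL hχ.1 2 f)) := by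
  let S : L2Circle →L[ℂ] IndSpace χ :=
    (((IndSpace.fourier χ).symm : L2Circle ≃L[ℂ] IndSpace χ) : L2Circle →L[ℂ] IndSpace χ) ∘L
      mulOp (fourierInfty k) ∘L (substL hχ.1 2).toContinuousLinearMap
  let U : IndSpace χ →L[ℂ] IndSpace χ :=
    ((indRep χ (GGrp.mk b 0) : IndSpace χ ≃L[ℂ] IndSpace χ) : _)
  have h : U ∘L S = (χ (BGrp.smul k b) : ℂ) • S := continuousLinearMap_ext_fourierLp fun n => by
    have h1 : S (fourierLp 2 n) = indBasis χ (k + q * n) := by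
      change (IndSpace.fourier χ).symm
        (mulOp (fourierInfty k) (substL hχ.1 2 (fourierLp 2 n))) = _
      rw [substL_fourierLp, mulOp_fourierInfty, IndSpace.fourier_symm_fourierLp]
    change indRep χ (GGrp.mk b 0) (S (fourierLp 2 n)) =
      (χ (BGrp.smul k b) : ℂ) • S (fourierLp 2 n)
    rw [h1, indRep_mk_zero_basis, ← BDual.comp_apply, hχ.comp_add_mul, BDual.comp_apply]
  exact DFunLike.congr_fun h f

theorem IsPeriodicPt.periodicOp_commutes (hχ : IsPeriodicPt a q χ) (f : LInftyCircle)
    (g : GGrp a) (φ : IndSpace χ) :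
    periodicOp χ hχ.1 f (indRep χ g φ) = indRep χ g (periodicOp χ hχ.1 f φ) := by
  have hb : ∀ (b : BGrp a) (φ : IndSpace χ), periodicOp χ hχ.1 f (indRep χ (GGrp.mk b 0) φ) =
      indRep χ (GGrp.mk b 0) (periodicOp χ hχ.1 f φ) := fun b φ => by
    let U : IndSpace χ →L[ℂ] IndSpace χ :=
      ((indRep χ (GGrp.mk b 0) : IndSpace χ ≃L[ℂ] IndSpace χ) : _)
    have h : periodicOp χ hχ.1 f ∘L U = U ∘L periodicOp χ hχ.1 f :=
      (indBasis χ).continuousLinearMap_ext fun k => by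
        change periodicOp χ hχ.1 f (indRep χ (GGrp.mk b 0) (indBasis χ k)) =
          indRep χ (GGrp.mk b 0) (periodicOp χ hχ.1 f (indBasis χ k))
        have h1 : periodicOp χ hχ.1 f (indBasis χ k) = (IndSpace.fourier χ).symm
            (mulOp (fourierInfty k) (substL hχ.1 2 (LInftyCircle.toL2 f))) := by
          rw [← mulOp_substL_fourierLp, ← IndSpace.fourier_basis (χ := χ)]
          rfl
        rw [indRep_mk_zero_basis, map_smul, h1, hχ.indRep_fourier_symm]
    exact DFunLike.congr_fun h φ
  rw [← GGrp.mk_eta g, indRep_mk]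
  change periodicOp χ hχ.1 f (indRep χ _ (indRep χ _ φ)) = indRep χ _ (indRep χ _ _)
  rw [hb, periodicOp_translate]

theorem IsPeriodicPt.periodicOp_mem_commutant (hχ : IsPeriodicPt a q χ) (f : LInftyCircle) :
    periodicOp χ hχ.1 f ∈ commutant (indCStarRep χ) :=
  GroupCStar.mem_commutant_lift_iff.2 (hχ.periodicOp_commutes f)

/-- The Fourier transform is unitary and the substitution is isometric on `L^∞`, so this is the norm
of a multiplication operator. -/
theorem norm_periodicOp (hq : 0 < q) (f : LInftyCircle) : ‖periodicOp χ hq f‖ = ‖f‖ := by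
  rw [← (substL hq ∞).norm_map f]
  refine le_antisymm (ContinuousLinearMap.opNorm_le_bound _ (norm_nonneg _) fun φ => ?_)
    (norm_le_of_mulOp_bound fun h => ?_)
  · rw [← (IndSpace.fourier χ).norm_map, fourier_periodicOp, ← (IndSpace.fourier χ).norm_map φ]
    exact norm_mulOp_apply_le _ _
  · have h1 := (periodicOp χ hq f).le_opNorm ((IndSpace.fourier χ).symm h)
    rwa [← (IndSpace.fourier χ).norm_map, fourier_periodicOp,
      LinearIsometryEquiv.apply_symm_apply, LinearIsometryEquiv.norm_map] at h1

/-- Commutation with translations makes `T` a multiplication by the transform of `T e_0`.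
Commutation with `B_a` kills its coefficients off `qℤ`, so the multiplier is `f(q ·)`; the norm of
`T` bounds the multiplier, and measure preservation transfers the bound to `f`. -/
theorem IsPeriodicPt.exists_periodicOp_eq (hχ : IsPeriodicPt a q χ)
    {T : IndSpace χ →L[ℂ] IndSpace χ} (hT : ∀ g φ, T (indRep χ g φ) = indRep χ g (T φ)) :
    ∃ f, periodicOp χ hχ.1 f = T := by
  let A : L2Circle →L[ℂ] L2Circle :=
    ((IndSpace.fourier χ : IndSpace χ ≃L[ℂ] L2Circle) : IndSpace χ →L[ℂ] L2Circle) ∘L T ∘L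
      (((IndSpace.fourier χ).symm : L2Circle ≃L[ℂ] IndSpace χ) : L2Circle →L[ℂ] IndSpace χ)
  have hAapply : ∀ h, A h = IndSpace.fourier χ (T ((IndSpace.fourier χ).symm h)) := fun _ => rfl
  have hA : ∀ n, A (fourierLp 2 n) = mulOp (fourierInfty n) (A (fourierLp 2 0)) := fun n => by
    have h1 : indBasis χ n = indRep χ (GGrp.mk 1 (-n)) (indBasis χ 0) := by
      rw [indRep_mk_one_basis, zero_sub, neg_neg]
    rw [hAapply, hAapply, IndSpace.fourier_symm_fourierLp, IndSpace.fourier_symm_fourierLp, h1, hT,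
      IndSpace.fourier_translate, neg_neg]
  have hmul := coeFn_of_commutes_fourier hA
  have hbound := ae_norm_le_of_mul_bound hmul A.le_opNorm
  obtain ⟨f, hf⟩ : ∃ f, substL hχ.1 2 f = A (fourierLp 2 0) := by
    refine exists_substL_eq hχ.1 fun j hj => ?_
    rw [hAapply, IndSpace.fourier_symm_fourierLp, ← IndSpace.fourier_basis (χ := χ),
      LinearIsometryEquiv.inner_map_map, inner_indBasis]
    exact coeff_eq_zero_of_commutes hT fun h => hj (hχ.dvd_of_comp_eq h)
  have hfbound : ∀ᵐ t ∂(AddCircle.haarAddCircle (T := (1 : ℝ))), ‖f t‖ ≤ ‖A‖ := by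
    have h1 : ∀ᵐ t ∂(AddCircle.haarAddCircle (T := (1 : ℝ))), ‖f (q • t)‖ ≤ ‖A‖ := by
      rw [← hf] at hbound
      filter_upwards [hbound, coeFn_substL hχ.1 2 f] with t h1 h2
      rwa [h2] at h1
    exact ae_of_ae_comp_nsmul hχ.1
      (measurableSet_le (Lp.stronglyMeasurable f).norm.measurable measurable_const) h1
  have hmem := memLp_top_of_bound (Lp.aestronglyMeasurable f) _ hfbound
  refine ⟨hmem.toLp f, ContinuousLinearMap.ext fun φ => (IndSpace.fourier χ).injective ?_⟩
  rw [fourier_periodicOp]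
  have h2 : IndSpace.fourier χ (T φ) = A (IndSpace.fourier χ φ) := by
    rw [hAapply, LinearIsometryEquiv.symm_apply_apply]
  rw [h2]
  refine Lp.ext ?_
  rw [← hf] at hmul
  filter_upwards [hmul (IndSpace.fourier χ φ),
    coeFn_mulOp (substL hχ.1 ∞ (hmem.toLp f)) (IndSpace.fourier χ φ), coeFn_substL hχ.1 2 f,
    coeFn_substL hχ.1 ∞ (hmem.toLp f), ae_comp_nsmul hχ.1 hmem.coeFn_toLp] with t h1 h2 h3 h4 h5
  rw [h1, h2, h3, h4, h5]

/-- The isomorphism from `L^∞(𝕋)` to the commutant. -/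
def IsPeriodicPt.commutantEquiv (hχ : IsPeriodicPt a q χ) :
    LInftyCircle ≃ₗᵢ[ℂ] commutant (indCStarRep χ) :=
  LinearIsometryEquiv.ofSurjective
    { toFun := fun f => ⟨periodicOp χ hχ.1 f, hχ.periodicOp_mem_commutant f⟩
      map_add' := fun f g => Subtype.ext (ContinuousLinearMap.ext fun φ => by
        change periodicOp χ hχ.1 (f + g) φ = periodicOp χ hχ.1 f φ + periodicOp χ hχ.1 g φ
        refine (IndSpace.fourier χ).injective ?_
        rw [map_add, fourier_periodicOp, fourier_periodicOp, fourier_periodicOp, map_add,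
          mulOp_add, add_apply])
      map_smul' := fun c f => Subtype.ext (ContinuousLinearMap.ext fun φ => by
        change periodicOp χ hχ.1 (c • f) φ = c • periodicOp χ hχ.1 f φ
        refine (IndSpace.fourier χ).injective ?_
        rw [map_smul, fourier_periodicOp, fourier_periodicOp, map_smul, mulOp_smul,
          smul_apply])
      norm_map' := fun f => norm_periodicOp hχ.1 f }
    fun T => by
      obtain ⟨f, hf⟩ := hχ.exists_periodicOp_eq (GroupCStar.mem_commutant_lift_iff.1 T.2)
      exact ⟨f, Subtype.ext hf⟩

theorem IsPeriodicPt.commutantEquiv_mul (hχ : IsPeriodicPt a q χ) {f g h : LInftyCircle}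
    (hh : h =ᵐ[AddCircle.haarAddCircle] fun t => f t * g t) :
    hχ.commutantEquiv h = hχ.commutantEquiv f * hχ.commutantEquiv g := by
  refine Subtype.ext (ContinuousLinearMap.ext fun φ => (IndSpace.fourier χ).injective ?_)
  change IndSpace.fourier χ (periodicOp χ hχ.1 h φ) =
    IndSpace.fourier χ (periodicOp χ hχ.1 f (periodicOp χ hχ.1 g φ))
  rw [fourier_periodicOp, fourier_periodicOp, fourier_periodicOp,
    mulOp_of_ae_mul (f := substL hχ.1 ∞ f) (g := substL hχ.1 ∞ g)]
  · rfl
  · filter_upwards [coeFn_substL hχ.1 ∞ f, coeFn_substL hχ.1 ∞ g, coeFn_substL hχ.1 ∞ h,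
      ae_comp_nsmul hχ.1 hh] with t h1 h2 h3 h4
    rw [h1, h2, h3, h4]

theorem IsPeriodicPt.commutantEquiv_star (hχ : IsPeriodicPt a q χ) {f g : LInftyCircle}
    (hg : g =ᵐ[AddCircle.haarAddCircle] fun t => star (f t)) :
    hχ.commutantEquiv g = star (hχ.commutantEquiv f) := by
  refine Subtype.ext ?_
  change periodicOp χ hχ.1 g = ContinuousLinearMap.adjoint (periodicOp χ hχ.1 f)
  refine (ContinuousLinearMap.eq_adjoint_iff _ _).2 fun φ ψ => ?_
  rw [← (IndSpace.fourier χ).inner_map_map, fourier_periodicOp,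
    ← (IndSpace.fourier χ).inner_map_map φ, fourier_periodicOp,
    mulOp_of_ae_star (f := substL hχ.1 ∞ f), ContinuousLinearMap.adjoint_inner_left]
  filter_upwards [coeFn_substL hχ.1 ∞ f, coeFn_substL hχ.1 ∞ g, ae_comp_nsmul hχ.1 hg]
    with t h1 h2 h3
  rw [h1, h2, h3]

/-! ### Generation of the commutant by continuous functions, and reducibility -/

theorem LInftyCircle.toL2_fourierInfty (n : ℤ) :
    LInftyCircle.toL2 (fourierInfty n) = fourierLp 2 n := by
  refine Lp.ext ?_
  filter_upwards [LInftyCircle.coeFn_toL2 (fourierInfty n), coeFn_fourierInfty n,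
    coeFn_fourierLp (T := (1 : ℝ)) 2 n] with t h1 h2 h3
  rw [h1, h2, h3]

/-- An operator that commutes with multiplication by `f(q ·)` for all continuous `f` does so for
all bounded measurable `f`. -/
theorem commutes_periodicOp_of_fourier (hq : 0 < q) {S : IndSpace χ →L[ℂ] IndSpace χ}
    (hS : ∀ n φ, S (periodicOp χ hq (fourierInfty n) φ) =
      periodicOp χ hq (fourierInfty n) (S φ)) (f : LInftyCircle) :
    S * periodicOp χ hq f = periodicOp χ hq f * S := by
  refine (indBasis χ).continuousLinearMap_ext fun k => (IndSpace.fourier χ).injective ?_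
  change IndSpace.fourier χ (S (periodicOp χ hq f (indBasis χ k))) =
    IndSpace.fourier χ (periodicOp χ hq f (S (indBasis χ k)))
  -- The vector `f(q ·) e_k` extends to a bounded function of `f ∈ L²`. The desired identity then
  -- describes a closed subspace of `L²`, and it holds on the characters.
  let D : L2Circle →L[ℂ] IndSpace χ :=
    (((IndSpace.fourier χ).symm : L2Circle ≃L[ℂ] IndSpace χ) : L2Circle →L[ℂ] IndSpace χ) ∘L
      mulOp (fourierInfty k) ∘L (substL hq 2).toContinuousLinearMap
  have hD : ∀ f, D (LInftyCircle.toL2 f) = periodicOp χ hq f (indBasis χ k) := fun f => by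
    refine (IndSpace.fourier χ).injective ?_
    rw [fourier_periodicOp, IndSpace.fourier_basis, mulOp_substL_fourierLp]
    exact LinearIsometryEquiv.apply_symm_apply _ _
  let A : L2Circle →L[ℂ] L2Circle :=
    ((IndSpace.fourier χ : IndSpace χ ≃L[ℂ] L2Circle) : IndSpace χ →L[ℂ] L2Circle) ∘L S ∘L D
  have hA : ∀ f, A (LInftyCircle.toL2 f) =
      IndSpace.fourier χ (S (periodicOp χ hq f (indBasis χ k))) := fun f => by
    rw [← hD]; rfl
  have hval : ∀ f, mulOp (substL hq ∞ f) (IndSpace.fourier χ (S (indBasis χ k)))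
      =ᵐ[AddCircle.haarAddCircle] fun t => IndSpace.fourier χ (S (indBasis χ k)) t *
        substL hq 2 (LInftyCircle.toL2 f) t := fun f => by
    filter_upwards [coeFn_mulOp (substL hq ∞ f) (IndSpace.fourier χ (S (indBasis χ k))),
      coeFn_substL hq ∞ f, coeFn_substL hq 2 (LInftyCircle.toL2 f),
      ae_comp_nsmul hq (LInftyCircle.coeFn_toL2 f)] with t h1 h2 h3 h4
    rw [h1, h2, h3, h4, mul_comm]
  have key := ae_eq_mul_of_mem_closure_span A (substL hq 2).toContinuousLinearMap
    (IndSpace.fourier χ (S (indBasis χ k))) (s := Set.range (fourierLp 2)) (by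
      rintro _ ⟨n, rfl⟩
      rw [← LInftyCircle.toL2_fourierInfty, hA, hS, fourier_periodicOp]
      exact hval _) (mem_closure_span_fourierLp (LInftyCircle.toL2 f))
  rw [← hA, fourier_periodicOp]
  exact Lp.ext (key.trans (hval f).symm)

/-- A commutant equals its own bicommutant, which gives one inclusion. For the other, whatever
commutes with the characters already commutes with all of `L^∞`. -/
theorem IsPeriodicPt.bicommutant_eq (hχ : IsPeriodicPt a q χ) :
    Set.centralizer (Set.centralizer (Set.range fun f : C(AddCircle (1 : ℝ), ℂ) =>
      (hχ.commutantEquiv (contToLInfty f) : IndSpace χ →L[ℂ] IndSpace χ))) =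
        commutant (indCStarRep χ) := by
  refine Set.Subset.antisymm ?_ ?_
  · have h1 : (Set.range fun f : C(AddCircle (1 : ℝ), ℂ) =>
        (hχ.commutantEquiv (contToLInfty f) : IndSpace χ →L[ℂ] IndSpace χ)) ⊆
        (commutant (indCStarRep χ) : Set (IndSpace χ →L[ℂ] IndSpace χ)) := by
      rintro _ ⟨f, rfl⟩
      exact (hχ.commutantEquiv (contToLInfty f)).2
    refine (Set.centralizer_subset (Set.centralizer_subset h1)).trans ?_
    rw [commutant, StarSubalgebra.coe_centralizer, Set.centralizer_centralizer_centralizer]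
  · intro T hT S hS
    obtain ⟨f, rfl⟩ := hχ.exists_periodicOp_eq (GroupCStar.mem_commutant_lift_iff.1 hT)
    exact commutes_periodicOp_of_fourier hχ.1 (fun n φ =>
      (DFunLike.congr_fun (hS _ ⟨fourier n, rfl⟩) φ).symm) f

/-- The induced representation of a periodic character is reducible. -/
theorem IsPeriodicPt.not_isIrreducibleRep (hχ : IsPeriodicPt a q χ) :
    ¬ IsIrreducibleRep (indCStarRep χ) := by
  rintro ⟨-, hirr⟩
  obtain ⟨f, g, hfg, hf, hg⟩ := exists_mul_eq_zero_LInftyCircle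
  -- Since `f g = 0`, this invariant kernel contains the nonzero range of the operator of `g`; it is
  -- proper because the operator of `f` is nonzero.
  let K : Submodule ℂ (IndSpace χ) := (periodicOp χ hχ.1 f).ker
  have hmul : ∀ φ, periodicOp χ hχ.1 f (periodicOp χ hχ.1 g φ) = 0 := fun φ => by
    have h1 := hχ.commutantEquiv_mul hfg
    rw [map_zero] at h1
    exact (DFunLike.congr_fun (congrArg Subtype.val h1) φ).symm
  have hne : ∀ f : LInftyCircle, f ≠ 0 → periodicOp χ hχ.1 f ≠ 0 := fun f hf h => by
    rw [← norm_ne_zero_iff, ← norm_periodicOp (χ := χ) hχ.1, h, norm_zero] at hf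
    exact hf rfl
  rcases hirr K (ContinuousLinearMap.isClosed_ker _) (fun x φ hφ => by
    have h1 := DFunLike.congr_fun ((StarSubalgebra.mem_centralizer_iff ℂ).1
      (hχ.periodicOp_mem_commutant f) _ ⟨x, rfl⟩).1 φ
    refine LinearMap.mem_ker.2 (h1.symm.trans ?_)
    change indCStarRep χ x (periodicOp χ hχ.1 f φ) = 0
    rw [show periodicOp χ hχ.1 f φ = 0 from hφ, map_zero]) with h | h
  · refine hne g hg (ContinuousLinearMap.ext fun φ => ?_)
    have h1 : periodicOp χ hχ.1 g φ ∈ K := hmul φ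
    rw [h] at h1
    exact (Submodule.mem_bot ℂ).1 h1
  · refine hne f hf (ContinuousLinearMap.ext fun φ => ?_)
    have h1 : φ ∈ K := h ▸ Submodule.mem_top
    exact h1

end Periodic

/-! ### Characters of the dual group -/

section DualHaar

variable {a : ℝˣ}

instance (a : ℝˣ) : (haarDual a).IsHaarMeasure := by unfold haarDual; infer_instance

instance (a : ℝˣ) : (haarDual a).Regular := by unfold haarDual; infer_instance

instance (a : ℝˣ) : IsProbabilityMeasure (haarDual a) :=
  ⟨Measure.haarMeasure_self (K₀ := (⊤ : TopologicalSpace.PositiveCompacts (BDual a)))⟩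

/-- Evaluation at `b` as a continuous function on the dual of `B_a`. -/
def evalMap (b : BGrp a) : C(BDual a, ℂ) := ⟨fun χ => χ b, continuous_eval b⟩

theorem evalMap_apply (b : BGrp a) (χ : BDual a) : evalMap b χ = χ b := rfl

/-- The exponential character with parameter `π / b` takes the value `-1` at `b`. -/
theorem BDual.exists_apply_ne_one {b : BGrp a} (hb : b ≠ 1) : ∃ χ : BDual a, χ b ≠ 1 := by
  have hv : b.val ≠ 0 := fun h => hb (BGrp.ext h)
  let φ : Additive (BGrp a) →+ ℝ := (BAdd a).subtype
  refine ⟨PontryaginDual.expLine φ (Real.pi / b.val), fun h => ?_⟩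
  rw [PontryaginDual.expLine_apply] at h
  change Circle.exp (Real.pi / b.val * b.val) = 1 at h
  rw [div_mul_cancel₀ _ hv] at h
  have h1 := congrArg (fun z : Circle => (z : ℂ)) h
  simp only [Circle.coe_exp, Complex.exp_pi_mul_I, Circle.coe_one] at h1
  norm_num at h1

/-- Translating by `χ₀` multiplies the integral by `χ₀(b)`, which can be chosen different from `1`
unless `b` is trivial. -/
theorem integral_evalMap (b : BGrp a) [Decidable (b = 1)] :
    ∫ χ : BDual a, (χ b : ℂ) ∂haarDual a = if b = 1 then 1 else 0 := by
  split_ifs with hb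
  · subst hb
    simp only [map_one, Circle.coe_one, integral_const, probReal_univ, one_smul]
  · obtain ⟨χ₀, hχ₀⟩ := BDual.exists_apply_ne_one hb
    have h1 := integral_mul_left_eq_self (μ := haarDual a) (fun χ : BDual a => (χ b : ℂ)) χ₀
    have h2 : ∀ χ : BDual a, ((χ₀ * χ) b : ℂ) = χ₀ b * χ b := fun _ => rfl
    simp only [h2, integral_const_mul] at h1
    have h3 : ((χ₀ b : ℂ) - 1) * ∫ χ : BDual a, (χ b : ℂ) ∂haarDual a = 0 := by
      rw [sub_mul, h1, one_mul, sub_self]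
    refine (mul_eq_zero.1 h3).resolve_left fun h => hχ₀ (Circle.coe_injective ?_)
    rw [sub_eq_zero.1 h, Circle.coe_one]

/-- The algebra of trigonometric polynomials on the dual of `B_a`. -/
def trigSubalgebra (a : ℝˣ) : StarSubalgebra ℂ C(BDual a, ℂ) where
  toSubalgebra := Algebra.adjoin ℂ (Set.range evalMap)
  star_mem' := by
    change Algebra.adjoin ℂ (Set.range (evalMap (a := a))) ≤
      star (Algebra.adjoin ℂ (Set.range (evalMap (a := a))))
    refine Algebra.adjoin_le ?_
    rintro _ ⟨b, rfl⟩
    refine Algebra.subset_adjoin ⟨b⁻¹, ContinuousMap.ext fun χ => ?_⟩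
    rw [evalMap_apply, map_inv, Circle.coe_inv_eq_conj]
    rfl

theorem trigSubalgebra_coe : Subalgebra.toSubmodule (trigSubalgebra a).toSubalgebra =
    Submodule.span ℂ (Set.range evalMap) := by
  refine Algebra.adjoin_eq_span_of_subset _ ?_
  intro x hx
  refine Submodule.subset_span ?_
  induction hx using Submonoid.closure_induction with
  | mem x hx => exact hx
  | one => exact ⟨1, ContinuousMap.ext fun χ => by rw [evalMap_apply, map_one]; rfl⟩
  | mul x y _ _ hx hy =>
    obtain ⟨b, rfl⟩ := hx
    obtain ⟨c, rfl⟩ := hy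
    exact ⟨b * c, ContinuousMap.ext fun χ => by rw [evalMap_apply, map_mul]; rfl⟩

/-- Stone–Weierstrass: evaluations separate characters, and their span is already a *-algebra. -/
theorem span_evalMap_closure_eq_top :
    (Submodule.span ℂ (Set.range (evalMap (a := a)))).topologicalClosure = ⊤ := by
  rw [← trigSubalgebra_coe]
  refine congrArg (Subalgebra.toSubmodule ∘ StarSubalgebra.toSubalgebra)
    (ContinuousMap.starSubalgebra_topologicalClosure_eq_top_of_separatesPoints
      (trigSubalgebra a) fun χ χ' h => ?_)
  obtain ⟨b, hb⟩ : ∃ b, χ b ≠ χ' b := by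
    by_contra! h'
    exact h (PontryaginDual.ext h')
  exact ⟨_, ⟨evalMap b, Algebra.subset_adjoin ⟨b, rfl⟩, rfl⟩,
    fun h' => hb (Circle.coe_injective h')⟩

theorem span_toLp_evalMap_closure_eq_top :
    (Submodule.span ℂ (Set.range fun b : BGrp a =>
      ContinuousMap.toLp 2 (haarDual a) ℂ (evalMap b))).topologicalClosure = ⊤ := by
  have h := (ContinuousMap.toLp_denseRange ℂ (haarDual a) ℂ
    (p := 2) (by norm_num)).topologicalClosure_map_submodule (span_evalMap_closure_eq_top (a := a))
  rw [Submodule.map_span, ← Set.range_comp] at h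
  exact h

/-- A square integrable function on the dual of `B_a` all of whose Fourier coefficients vanish is
zero almost everywhere. -/
theorem ae_eq_zero_of_integral_mul_eq_zero {t : BDual a → ℂ} (ht : MemLp t 2 (haarDual a))
    (h : ∀ b : BGrp a, ∫ χ : BDual a, (χ b : ℂ) * t χ ∂haarDual a = 0) : t =ᵐ[haarDual a] 0 := by
  have h1 : ht.toLp t = 0 := by
    refine Dense.eq_zero_of_inner_right ℂ ((Submodule.dense_iff_topologicalClosure_eq_top).2
      (span_toLp_evalMap_closure_eq_top (a := a))) fun v hv => ?_
    have hle : Submodule.span ℂ (Set.range fun b : BGrp a =>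
        ContinuousMap.toLp 2 (haarDual a) ℂ (evalMap b)) ≤ (ℂ ∙ ht.toLp t)ᗮ := by
      refine Submodule.span_le.2 ?_
      rintro _ ⟨b, rfl⟩
      refine (Submodule.mem_orthogonal_singleton_iff_inner_left).2 ?_
      -- The inner product conjugates `χ(b)` into `χ(b⁻¹)`, so the coefficient at `b⁻¹` is the one
      -- needed.
      rw [L2.inner_def, ← h b⁻¹]
      refine integral_congr_ae ?_
      filter_upwards [ContinuousMap.coeFn_toLp (p := 2) (𝕜 := ℂ) (haarDual a) (evalMap b),
        ht.coeFn_toLp] with χ h1 h2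
      rw [h1, h2, RCLike.inner_apply, evalMap_apply, map_inv, Circle.coe_inv_eq_conj, mul_comm]
    exact (Submodule.mem_orthogonal_singleton_iff_inner_left).1 (hle hv)
  filter_upwards [ht.coeFn_toLp, Lp.eq_zero_iff_ae_eq_zero.1 h1] with χ h2 h3
  rw [← h2, h3]

end DualHaar

/-! ### Decomposition of the regular representation -/

section Regular

variable {a : ℝˣ}

/-- The section `χ ↦ χ(c)⁻¹ e_k` attached to `(c, k) ∈ G_a`. -/
def deltaFun (g : GGrp a) (χ : BDual a) : IndSpace χ := (χ g.left⁻¹ : ℂ) • indBasis χ g.exp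

theorem coeff_deltaFun (g : GGrp a) (χ : BDual a) (k : ℤ) :
    (deltaFun g χ).coeff k = χ g.left⁻¹ * if k = g.exp then 1 else 0 := by
  rw [deltaFun, IndSpace.coeff_smul, IndSpace.coeff_indBasis]

theorem isL2Section_deltaFun (g : GGrp a) :
    IsL2Section (fun χ : BDual a => indBasis χ) (haarDual a) (deltaFun g) := by
  refine ⟨fun i => ?_, ?_⟩
  · have h : ∀ χ : BDual a, inner ℂ (indBasis χ i) (deltaFun g χ) =
        (χ g.left⁻¹ : ℂ) * if i = g.exp then 1 else 0 := fun χ => by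
      rw [inner_indBasis]
      exact coeff_deltaFun g χ i
    simp only [h]
    exact ((continuous_eval _).measurable.mul_const _).aemeasurable
  · have h : ∀ χ : BDual a, ‖deltaFun g χ‖ₑ = 1 := fun χ => by
      rw [← ofReal_norm, deltaFun, norm_smul, Circle.norm_coe, one_mul,
        (indBasis χ).orthonormal.1, ENNReal.ofReal_one]
    simp only [h, one_pow, lintegral_const, one_mul]
    exact measure_lt_top _ _

/-- The section `χ ↦ χ(c)⁻¹ e_k` as a square integrable section. -/
def deltaSection (g : GGrp a) : L2Section (fun χ : BDual a => indBasis χ) (haarDual a) :=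
  (⟨_, isL2Section_deltaFun g⟩ : l2Sections _ _)

/-- The vector of the direct integral attached to a group element. -/
def deltaVec (g : GGrp a) : IndIntegral a := SeparationQuotient.mk (deltaSection g)

theorem inner_deltaFun (g : GGrp a) (χ : BDual a) (φ : IndSpace χ) :
    inner ℂ (deltaFun g χ) φ = (χ g.left : ℂ) * φ.coeff g.exp := by
  rw [deltaFun, inner_smul_left, inner_indBasis, map_inv, Circle.coe_inv_eq_conj, Complex.conj_conj]
  rfl

/-- Coefficients against these vectors are Fourier coefficients of the coordinate functions of a
section. -/
theorem inner_deltaVec (g : GGrp a)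
    (t : L2Section (fun χ : BDual a => indBasis χ) (haarDual a)) :
    inner ℂ (deltaVec g) (SeparationQuotient.mk t : IndIntegral a) =
      ∫ χ : BDual a, (χ g.left : ℂ) * (t.val χ).coeff g.exp ∂haarDual a :=
  integral_congr_ae (Filter.Eventually.of_forall fun χ => inner_deltaFun g χ (t.val χ))

theorem orthonormal_deltaVec : Orthonormal ℂ (deltaVec (a := a)) := by
  classical
  refine orthonormal_iff_ite.2 fun g h => ?_
  rw [show deltaVec h = SeparationQuotient.mk (deltaSection h) from rfl, inner_deltaVec]
  have h1 : ∀ χ : BDual a, (χ g.left : ℂ) * ((deltaSection h).val χ).coeff g.exp =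
      (χ (g.left * h.left⁻¹) : ℂ) * if g.exp = h.exp then 1 else 0 := fun χ => by
    change (χ g.left : ℂ) * (deltaFun h χ).coeff g.exp = _
    rw [coeff_deltaFun, ← mul_assoc, map_mul, Circle.coe_mul]
  simp only [h1, integral_mul_const, integral_evalMap, mul_inv_eq_one]
  have h2 : g = h ↔ g.left = h.left ∧ g.exp = h.exp := SemidirectProduct.ext_iff
  by_cases hl : g.left = h.left <;> by_cases he : g.exp = h.exp <;> simp [h2, hl, he]

/-- Each coordinate of an orthogonal section has zero Fourier coefficients, so it vanishes almost
everywhere; countably many coordinates vanish together. -/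
theorem orthogonal_span_deltaVec : (Submodule.span ℂ (Set.range (deltaVec (a := a))))ᗮ = ⊥ := by
  refine (Submodule.eq_bot_iff _).2 fun x hx => ?_
  obtain ⟨t, rfl⟩ := SeparationQuotient.surjective_mk x
  have hcoeff : ∀ k, (fun χ => (t.val χ).coeff k) =ᵐ[haarDual a] 0 := fun k => by
    refine ae_eq_zero_of_integral_mul_eq_zero ?_ fun b => ?_
    · exact ((isL2Section_iff _ _ _).1 t.isL2).continuousLinearMap_comp
        (lp.evalCLM ℂ (fun _ : ℤ => ℂ) 2 k)
    · rw [← (Submodule.mem_orthogonal _ _).1 hx (deltaVec (GGrp.mk b k))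
        (Submodule.subset_span ⟨_, rfl⟩), inner_deltaVec]
      rfl
  refine (inner_self_eq_zero (𝕜 := ℂ)).1 ?_
  change ∫ χ, inner ℂ (t.val χ) (t.val χ) ∂haarDual a = 0
  refine integral_eq_zero_of_ae ?_
  filter_upwards [ae_all_iff.2 hcoeff] with χ hχ
  have h0 : t.val χ = 0 := IndSpace.ext_coeff hχ
  rw [h0, inner_zero_left]
  rfl

/-- The Hilbert basis of the direct integral indexed by the group. -/
def deltaBasis (a : ℝˣ) : HilbertBasis (GGrp a) ℂ (IndIntegral a) :=
  HilbertBasis.mkOfOrthogonalEqBot orthonormal_deltaVec orthogonal_span_deltaVec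

theorem deltaBasis_apply (g : GGrp a) : deltaBasis a g = deltaVec g :=
  congrFun (HilbertBasis.coe_mkOfOrthogonalEqBot _ _) g

/-- The weight `χ(a^k b)` of the representation cancels the same factor in the inverse of the
`B_a`-component of `h g`. Point masses obey the same rule under right translation. -/
theorem rep_deltaVec (g h : GGrp a) :
    DirectIntegral.rep (measurable_indRep a (haarDual a)) g (deltaVec (h * g)) = deltaVec h := by
  refine (DirectIntegral.rep_mk _ g (deltaSection (h * g))).trans
    (congrArg SeparationQuotient.mk (Subtype.ext (funext fun χ => IndSpace.ext_coeff fun k => ?_)))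
  change (indRep χ g (deltaFun (h * g) χ)).coeff k = (deltaFun h χ).coeff k
  rw [IndSpace.coeff_indRep, coeff_deltaFun, coeff_deltaFun]
  have h1 : (h * g).left = h.left * BGrp.smul h.exp g.left := rfl
  have h2 : (h * g).exp = h.exp + g.exp := rfl
  rw [h1, h2]
  simp only [add_left_inj]
  by_cases hk : k = h.exp
  · rw [hk, if_pos rfl, mul_one, mul_one, ← Circle.coe_mul, ← map_mul, mul_inv_rev,
      mul_inv_cancel_left]
  · rw [if_neg hk, mul_zero, mul_zero, mul_zero]

theorem rightRegular_single {G : Type} [Group G] [DecidableEq G] (g h : G) :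
    rightRegular G g (lp.single 2 (h * g) 1) = lp.single 2 h 1 := by
  refine lp.ext (funext fun x => ?_)
  change (lp.single 2 (h * g) (1 : ℂ) : lp (fun _ : G => ℂ) 2) (x * g) = _
  rw [lp.single_apply, lp.single_apply, Pi.single_apply, Pi.single_apply]
  simp only [mul_left_inj]

/-- The right regular representation is the direct integral of the induced representations. -/
theorem unitarilyEquivalent_regular_integral (a : ℝˣ) :
    UnitarilyEquivalent (regularCStarRep a) (indIntegralRep a) := by
  classical
  rw [regularCStarRep, indIntegralRep, GroupCStar.unitarilyEquivalent_lift_iff]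
  refine ⟨(deltaBasis a).repr.symm, fun g ξ => ?_⟩
  let R : lp (fun _ : GGrp a => ℂ) 2 →L[ℂ] lp (fun _ : GGrp a => ℂ) 2 :=
    (rightRegular (GGrp a) g).toContinuousLinearEquiv.toContinuousLinearMap
  let D : IndIntegral a →L[ℂ] IndIntegral a :=
    (DirectIntegral.rep (measurable_indRep a (haarDual a))
      g).toContinuousLinearEquiv.toContinuousLinearMap
  let V : IndIntegral a →L[ℂ] lp (fun _ : GGrp a => ℂ) 2 :=
    (deltaBasis a).repr.toContinuousLinearEquiv.toContinuousLinearMap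
  -- Bounded operators are compared on the basis; writing each index as `h g` makes the permutation
  -- rule applicable.
  have h : V ∘L D = R ∘L V := (deltaBasis a).continuousLinearMap_ext fun h => by
    obtain ⟨h, rfl⟩ : ∃ h', h = h' * g := ⟨h * g⁻¹, (inv_mul_cancel_right h g).symm⟩
    change (deltaBasis a).repr (DirectIntegral.rep (measurable_indRep a (haarDual a)) g
      (deltaBasis a (h * g))) = rightRegular (GGrp a) g ((deltaBasis a).repr (deltaBasis a (h * g)))
    rw [HilbertBasis.repr_self, rightRegular_single, deltaBasis_apply, rep_deltaVec,
      ← deltaBasis_apply, HilbertBasis.repr_self]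
  have h1 := DFunLike.congr_fun h ((deltaBasis a).repr.symm ξ)
  change (deltaBasis a).repr (DirectIntegral.rep (measurable_indRep a (haarDual a)) g
    ((deltaBasis a).repr.symm ξ)) =
      rightRegular (GGrp a) g ((deltaBasis a).repr ((deltaBasis a).repr.symm ξ)) at h1
  rw [LinearIsometryEquiv.apply_symm_apply] at h1
  rw [← h1, LinearIsometryEquiv.symm_apply_apply]

end Regular

end

theorem theorem3p5 (a : ℝˣ) (ha : 0 < (a : ℝ)) (ha1 : a ≠ 1) (halg : IsAlgebraic ℚ (a : ℝ)) :
    -- (i) with the identification `ψ` of the dual of `B_a` with `S_a`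
    (∃ ψ : BDual a ≃ₜ* Solenoid (a : ℝ),
      (∀ (χ : BDual a) (k : ℤ) (i : Fin (polyDeg (a : ℝ))),
        (ψ χ).coord k i = χ (BGrp.pow a (k + (i : ℕ)))) ∧
      ∃ e : SolenoidOrbits (a : ℝ) ≃ inducedClasses a,
        ∀ χ : BDual a, (e (Quotient.mk _ (ψ χ)) : RepClass (UAlg a)) = repClass (indCStarRep χ)) ∧
    -- (ii)
    (∀ χ : BDual a, IsIrreducibleRep (indCStarRep χ) ↔ IsAperiodicPt a χ) ∧
    -- (iii) the commutant is `L^∞(𝕋)`, generated as a von Neumann algebra by `C(𝕋)`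
    (∀ (q : ℕ) (χ : BDual a), IsPeriodicPt a q χ →
      ∃ Φ : LInftyCircle ≃ₗᵢ[ℂ] commutant (indCStarRep χ),
        (∀ f g h : LInftyCircle,
          (h =ᵐ[AddCircle.haarAddCircle] fun t => f t * g t) → Φ h = Φ f * Φ g) ∧
        (∀ f g : LInftyCircle,
          (g =ᵐ[AddCircle.haarAddCircle] fun t => star (f t)) → Φ g = star (Φ f)) ∧
        Set.centralizer (Set.centralizer (Set.range fun f : C(AddCircle (1 : ℝ), ℂ) =>
          (Φ (contToLInfty f) : IndSpace χ →L[ℂ] IndSpace χ))) = commutant (indCStarRep χ)) ∧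
    -- (iv)
    UnitarilyEquivalent (regularCStarRep a) (indIntegralRep a) := by
  refine ⟨⟨BDual.solenoidEquiv halg, BDual.coord_solenoidEquiv halg,
    exists_orbits_equiv_inducedClasses (BDual.solenoidEquiv halg).toEquiv
      (BDual.solenoidEquiv_dualAut halg)⟩, fun χ => ⟨fun h => ?_, fun h => h.isIrreducibleRep⟩,
    fun q χ hχ => ⟨hχ.commutantEquiv, fun _ _ _ => hχ.commutantEquiv_mul,
      fun _ _ => hχ.commutantEquiv_star, hχ.bicommutant_eq⟩, unitarilyEquivalent_regular_integral a⟩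
  by_contra hap
  obtain ⟨q, hq⟩ := IsPeriodicPt.exists_of_not_isAperiodicPt hap
  exact hq.not_isIrreducibleRep h
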